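/- **Setting.** Let $T>0$, $x_0\in\mathbb R^n$, let $f_1,\dots,f_N:\mathbb R^n\to\mathbb R^n$ and $\ell:\mathbb R^n\to\mathbb R$ be $C^2$ with bounded second derivatives, and put $F(y,w)=\sum_{i=1}^N w_if_i(y)$. A mode schedule consists of modes $\sigma_1,\dots,\sigma_M\in\{1,\dots,N\}$, consecutive ones distinct, and switching times $0<T_1<\dots<T_{M-1}<T$; its switching control is $u(t)=e_{\sigma_i}$ on $[T_{i-1},T_i)$ ($T_0=0$, $T_M=T$). Controls equal to such a $u$ almost everywhere on $[0,T]$ have this schedule. A pair $(x,v)$ is feasible if $v$ has a mode schedule and $x(t)=x_0+\int_0^tF(x(s),v(s))\,ds$ for $t\in[0,T]$; its cost is $\int_0^T\ell(x(s))\,ds$. Fix a mode schedule with control $u$ and a feasible pair $(x,u)$. Let $\rho$ be the continuous solution of $\dot\rho=-D_1F(x,u)^T\rho-D\ell(x)^T$ (away from the switching times of $u$), $\rho(T)=0$. The mode insertion gradient is $d_a(t)=\rho(t)^T\big(f_a(x(t))-F(x(t),u(t))\big)$, $a=1,\dots,N$; write $d_{ab}=d_a-d_b$ and assume that for all $a\ne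 b$, $d_{ab}$ has only finitely many points in $[0,T]$ at which it is not differentiable or has zero derivative. Let $\theta=\inf_{a,\;t\in[0,T]}d_a(t)$, assume $\theta<0$, and set $\gamma_0=-1/\theta$. For $\mu:[0,T]\to\mathbb R^N$ let $\mathcal Q_i(\mu(t))=\prod_{j\neq i}1(\mu_i(t)-\mu_j(t))$, where $1(s)=1$ if $s\ge0$ and $1(s)=0$ if $s<0$. Let $\mathcal P(\mu)=(y,\mathcal Q(\mu))$, with $y$ the solution of the state equation under the control $\mathcal Q(\mu)$, and let $J(\gamma)$ be the cost of $\mathcal P(u-\gamma d)$. For $\gamma>\gamma_0$ close to $\gamma_0$, the control $\mathcal Q(u-\gamma d)$ has a mode schedule whose mode sequence $\sigma_1,\dots,\sigma_M$ does not depend on $\gamma$; let $T_1(\gamma)<\dots<T_{M-1}(\gamma)$ be its switching times. For a function $g$ of time let $g(T_i(\gamma_0^+))=\lim_{\gamma\downarrow\gamma_0}g(T_i(\gamma))$; in particular $T_i(\gamma_0^+)=\lim_{\gamma\downarrow\gamma_0}T_i(\gamma)$. The type of $T_i(\gamma_0^+)$ is $0$ if $T_i(\gamma)$ is constant for $\gamma>\gamma_0$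 near $\gamma_0$, and otherwise the least $k\ge1$ with $D^kd_{\sigma_i\sigma_{i+1}}(T_i(\gamma_0^+))\ne0$ ($\infty$ if there is none). Let $\overline m$ be the greatest type and $I_k$ the set of indices of type $k$. Let $\omega_i=0$ if $T_i(\gamma)>T_i(\gamma_0^+)$ for $\gamma>\gamma_0$ near $\gamma_0$, and $\omega_i=1$ otherwise. Define $$\hat J(1;\gamma)=J(0)+\sum_{i\in I_1}(-1)^{\omega_i}\frac{\theta^3}{\dot d_{\sigma_{i+\omega_i}}(T_i(\gamma_0^+))}(\gamma-\gamma_0),$$ $$\hat J(2;\gamma)=J(0)-\sum_{i\in I_2}\frac{\sqrt2\,\theta^2}{\ddot d_{\sigma_{i+\omega_i}}(T_i(\gamma_0^+))^{1/2}}(\gamma-\gamma_0)^{1/2},$$ and let $R(\gamma)=J(\gamma)-\hat J(\overline m;\gamma)$. **Lemma (Approximation of the cost).** The mode sequence of $\mathcal Q(u-\gamma d)$ is indeed constant for $\gamma>\gamma_0$ near $\gamma_0$. If $\overline m=1$ or $\overline m=2$, then there is $\delta\gamma>0$ such that for all $\gamma\in(\gamma_0,\gamma_0+\delta\gamma)$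 the pair $\mathcal P(u-\gamma d)$ exists and is feasible, and $$|\hat J(\overline m;\gamma)-J(0)|\ \ge\ |R(\gamma)|.$$ -/

import Mathlib

open Set MeasureTheory

namespace SwitchedSystem

/-- The state space `ℝⁿ`. -/
abbrev State (n : ℕ) : Type := EuclideanSpace ℝ (Fin n)

/-- The switched vector field `F(y, w) = ∑ᵢ wᵢ fᵢ(y)`. -/
noncomputable def field {n N : ℕ} (f : Fin N → State n → State n) (y : State n)
    (w : Fin N → ℝ) : State n :=
  ∑ i, w i • f i y

/-- A mode schedule on `[0, T]` with mode sequence `σ₀, …, σ_m` and switching times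
`τ₀ < ⋯ < τ_{m-1}`: the times lie in `(0, T)` and consecutive modes are distinct.  (There are
`m + 1` modes; `τ i` separates the modes `σ i.castSucc` and `σ i.succ`.)  Such a schedule is
finite, hence non-chattering. -/
structure IsModeSchedule {N m : ℕ} (T : ℝ) (σ : Fin (m + 1) → Fin N) (τ : Fin m → ℝ) : Prop where
  strictMono : StrictMono τ
  mem_Ioo : ∀ i, τ i ∈ Ioo 0 T
  mode_ne : ∀ i : Fin m, σ i.castSucc ≠ σ i.succ

/-- The mode that is active at time `t`: its position in the mode sequence is the number of
switching times `≤ t`, so mode `σ i` is active on the half-open interval from the `i`-th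
switching time (included) to the next one (excluded). -/
noncomputable def activeMode {N m : ℕ} (σ : Fin (m + 1) → Fin N) (τ : Fin m → ℝ) (t : ℝ) : Fin N :=
  σ ⟨(Finset.univ.filter fun i => τ i ≤ t).card,
    Nat.lt_succ_of_le ((Finset.card_le_univ _).trans (Fintype.card_fin m).le)⟩

/-- The switching control `u(t) = e_{σ_i}` of a mode schedule. -/
noncomputable def scheduleControl {N m : ℕ} (σ : Fin (m + 1) → Fin N) (τ : Fin m → ℝ) (t : ℝ) :
    Fin N → ℝ :=
  Pi.single (activeMode σ τ t) 1

/-- `(σ, τ)` is the mode schedule of the control `v` on `[0, T]`.  Values of `v` on null sets do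
not matter. -/
def HasSchedule {N m : ℕ} (T : ℝ) (σ : Fin (m + 1) → Fin N) (τ : Fin m → ℝ)
    (v : ℝ → Fin N → ℝ) : Prop :=
  IsModeSchedule T σ τ ∧ ∀ᵐ t ∂(volume.restrict (Icc 0 T)), v t = scheduleControl σ τ t

/-- `x` solves the state equation `ẋ = F(x, v)`, `x(0) = x₀` on `[0, T]` in integral form. -/
structure IsTrajectory {n N : ℕ} (f : Fin N → State n → State n) (x₀ : State n) (T : ℝ)
    (v : ℝ → Fin N → ℝ) (x : ℝ → State n) : Prop where
  integrable : IntervalIntegrable (fun s => field f (x s) (v s)) volume 0 T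
  eq : ∀ t ∈ Icc 0 T, x t = x₀ + ∫ s in (0 : ℝ)..t, field f (x s) (v s)

/-- The set `𝒮` of feasible switched system trajectories `(x, u)`. -/
def IsFeasible {n N : ℕ} (f : Fin N → State n → State n) (x₀ : State n) (T : ℝ)
    (p : (ℝ → State n) × (ℝ → Fin N → ℝ)) : Prop :=
  (∃ (m : ℕ) (σ : Fin (m + 1) → Fin N) (τ : Fin m → ℝ), HasSchedule T σ τ p.2) ∧
    IsTrajectory f x₀ T p.2 p.1

/-- The cost `J(x, u) = ∫₀ᵀ ℓ(x(s)) ds`. -/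
noncomputable def cost {n N : ℕ} (ℓ : State n → ℝ) (T : ℝ)
    (p : (ℝ → State n) × (ℝ → Fin N → ℝ)) : ℝ :=
  ∫ s in (0 : ℝ)..T, ℓ (p.1 s)

/-- `ρ` solves the adjoint equation `ρ̇ = -Df_{σ_i}(x)ᵀ ρ - Dℓ(x)ᵀ` between consecutive switching
times, `ρ(T) = 0`. -/
structure IsAdjoint {n N m : ℕ} (f : Fin N → State n → State n) (ℓ : State n → ℝ) (T : ℝ)
    (σ : Fin (m + 1) → Fin N) (τ : Fin m → ℝ) (x ρ : ℝ → State n) : Prop where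
  continuousOn : ContinuousOn ρ (Icc 0 T)
  hasDerivAt : ∀ t ∈ Ioo 0 T, t ∉ range τ →
    HasDerivAt ρ (-(ContinuousLinearMap.adjoint (fderiv ℝ (f (activeMode σ τ t)) (x t)) (ρ t))
      - gradient ℓ (x t)) t
  terminal : ρ T = 0

/-- The mode insertion gradient `d_a(t) = ρ(t)ᵀ (f_a(x(t)) - F(x(t), u(t)))`. -/
noncomputable def insertionGradient {n N : ℕ} (f : Fin N → State n → State n)
    (x : ℝ → State n) (u : ℝ → Fin N → ℝ) (ρ : ℝ → State n) (t : ℝ) (a : Fin N) : ℝ :=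
  inner ℝ (ρ t) (f a (x t) - field f (x t) (u t))

/-- The critical points in `[0, T]` of the difference `d_a - d_b`. -/
def criticalPoints {N : ℕ} (T : ℝ) (d : ℝ → Fin N → ℝ) (a b : Fin N) : Set ℝ :=
  {t ∈ Icc 0 T | ¬ DifferentiableAt ℝ (fun s => d s a - d s b) t ∨
    deriv (fun s => d s a - d s b) t = 0}

/-- The optimality function `θ`: the lower bound of `d_a(t)` over all modes and all times. -/
noncomputable def theta {N : ℕ} (T : ℝ) (d : ℝ → Fin N → ℝ) : ℝ :=
  sInf {r | ∃ a : Fin N, ∃ t ∈ Icc 0 T, d t a = r}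

/-- The mapping `𝒬`: `𝒬ᵢ(μ) = ∏_{j ≠ i} 1(μᵢ - μⱼ)` with the step function `1(s) = 1` iff
`s ≥ 0`. -/
noncomputable def maxMap {N : ℕ} (w : Fin N → ℝ) (i : Fin N) : ℝ :=
  ∏ j ∈ Finset.univ.erase i, if 0 ≤ w i - w j then 1 else 0

/-- The max-projection `𝒫(μ) = (x, 𝒬(μ))`, where `x` is the solution of the state equation under
the control `𝒬(μ)`. -/
noncomputable def maxProj {n N : ℕ} (f : Fin N → State n → State n) (x₀ : State n) (T : ℝ)
    (μ : ℝ → Fin N → ℝ) : (ℝ → State n) × (ℝ → Fin N → ℝ) :=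
  (Classical.epsilon (IsTrajectory f x₀ T fun t => maxMap (μ t)), fun t => maxMap (μ t))

/-- `(σ, τ(γ))` is the mode schedule `(Σ(γ), 𝒯(γ))` of `𝒬(u - γ d)` for all `γ > γ₀` near `γ₀`;
the mode sequence is constant there, only the switching times vary. -/
def IsScheduleAfter {N m : ℕ} (T : ℝ) (u d : ℝ → Fin N → ℝ) (γ₀ : ℝ)
    (σ : Fin (m + 1) → Fin N) (τ : ℝ → Fin m → ℝ) : Prop :=
  ∃ δ > 0, ∀ γ ∈ Ioo γ₀ (γ₀ + δ),
    HasSchedule T σ (τ γ) fun t => maxMap (u t - γ • d t)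

/-- `g(T_i(γ₀⁺))`: the limit of `g(T_i(γ))` as `γ ↓ γ₀`.  For `g` continuous at `T_i(γ₀⁺)` this is
the value of `g` there; for derivatives of `d`, which may jump at a switching time of `u`, it is
the one-sided value from the side on which `T_i(γ)` lies. -/
noncomputable def atSwitch {m : ℕ} (γ₀ : ℝ) (τ : ℝ → Fin m → ℝ) (i : Fin m) (g : ℝ → ℝ) : ℝ :=
  Function.rightLim (fun γ => g (τ γ i)) γ₀

open Classical in
/-- The type `m(T_i(γ₀⁺))` of a switching time: `0` if `T_i(γ)` is constant for `γ > γ₀` near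
`γ₀`, otherwise the least `k ≥ 1` with `Dᵏ d_{σ_i σ_{i+1}}(T_i(γ₀⁺)) ≠ 0` (`⊤` if there is
none). -/
noncomputable def switchType {N m : ℕ} (d : ℝ → Fin N → ℝ) (γ₀ : ℝ)
    (σ : Fin (m + 1) → Fin N) (τ : ℝ → Fin m → ℝ) (i : Fin m) : ℕ∞ :=
  if ∃ δ > 0, ∃ c, ∀ γ ∈ Ioo γ₀ (γ₀ + δ), τ γ i = c then 0
  else sInf {k : ℕ∞ | ∃ j : ℕ, 1 ≤ j ∧ k = j ∧
    atSwitch γ₀ τ i (iteratedDeriv j fun s => d s (σ i.castSucc) - d s (σ i.succ)) ≠ 0}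

/-- The greatest type `m̄` among the switching times at `γ₀⁺`. -/
noncomputable def maxType {N m : ℕ} (d : ℝ → Fin N → ℝ) (γ₀ : ℝ)
    (σ : Fin (m + 1) → Fin N) (τ : ℝ → Fin m → ℝ) : ℕ∞ :=
  Finset.univ.sup (switchType d γ₀ σ τ)

open Classical in
/-- The index set `I_k` of the switching times of type `k`. -/
noncomputable def typeSet {N m : ℕ} (d : ℝ → Fin N → ℝ) (γ₀ : ℝ)
    (σ : Fin (m + 1) → Fin N) (τ : ℝ → Fin m → ℝ) (k : ℕ∞) : Finset (Fin m) :=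
  Finset.univ.filter fun i => switchType d γ₀ σ τ i = k

/-- `T_i(γ) > T_i(γ₀⁺)` for all `γ > γ₀` near `γ₀`. -/
def IsIncreasingSwitch {m : ℕ} (γ₀ : ℝ) (τ : ℝ → Fin m → ℝ) (i : Fin m) : Prop :=
  ∃ δ > 0, ∀ γ ∈ Ioo γ₀ (γ₀ + δ), atSwitch γ₀ τ i id < τ γ i

open Classical in
/-- `ω_i`: `0` if `T_i(γ)` increases with `γ > γ₀` near `γ₀`, and `1` otherwise. -/
noncomputable def omega {m : ℕ} (γ₀ : ℝ) (τ : ℝ → Fin m → ℝ) (i : Fin m) : ℕ :=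
  if IsIncreasingSwitch γ₀ τ i then 0 else 1

open Classical in
/-- The mode `σ_{i + ω_i}`. -/
noncomputable def movingMode {N m : ℕ} (γ₀ : ℝ) (σ : Fin (m + 1) → Fin N)
    (τ : ℝ → Fin m → ℝ) (i : Fin m) : Fin N :=
  if IsIncreasingSwitch γ₀ τ i then σ i.castSucc else σ i.succ

/-- The approximation `Ĵ(1; γ)`, linear in `γ - γ₀`. -/
noncomputable def approxCostOne {N m : ℕ} (J₀ θ : ℝ) (d : ℝ → Fin N → ℝ) (γ₀ : ℝ)
    (σ : Fin (m + 1) → Fin N) (τ : ℝ → Fin m → ℝ) (γ : ℝ) : ℝ :=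
  J₀ + (∑ i ∈ typeSet d γ₀ σ τ 1, (-1) ^ omega γ₀ τ i * θ ^ 3 /
    atSwitch γ₀ τ i (deriv fun s => d s (movingMode γ₀ σ τ i))) * (γ - γ₀)

/-- The approximation `Ĵ(2; γ)`, linear in `(γ - γ₀)^{1/2}`. -/
noncomputable def approxCostTwo {N m : ℕ} (J₀ θ : ℝ) (d : ℝ → Fin N → ℝ) (γ₀ : ℝ)
    (σ : Fin (m + 1) → Fin N) (τ : ℝ → Fin m → ℝ) (γ : ℝ) : ℝ :=
  J₀ - (∑ i ∈ typeSet d γ₀ σ τ 2, √2 * θ ^ 2 /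
    √(atSwitch γ₀ τ i (iteratedDeriv 2 fun s => d s (movingMode γ₀ σ τ i)))) * √(γ - γ₀)

end SwitchedSystem

open SwitchedSystem

/-! Let E(γ) be the total time in [0, T] during which the modes of 𝒬(u - γd) and of u differ.
Pairing the difference of the two trajectories with the adjoint ρ gives J(γ) - J(0) = ∫ d_c dt +
O(E²), where the integral runs over the times of disagreement and c is the mode of 𝒬(u - γd)
(`exists_cost_expansion`). At such times d_c lies between θ and -1/γ: the lower bound is the
definition of θ, and the upper one holds because c beats the mode of u only if -γ d_c ≥ 1. Since
-1/γ tends to θ as γ ↓ γ₀, it follows that J(γ) - J(0) = θE + o(E)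
(`eventually_feasible_and_cost_bounds`).

It remains to compute E. The end points, the switching times of u, and the critical points and zeros
of all d_a - d_b (finitely many zeros, by Rolle) cut [0, T] into finitely many intervals. On each of
them a single mode a has the least insertion gradient, and unless a is the mode of u, d_a is
strictly monotone. For γ near γ₀ the set where d_a < -1/γ is therefore empty or a short piece at the
end where d_a tends to θ (`insertsAtMostOnce_of_regular`). Gluing the intervals gives a schedule
with constant mode sequence for which E is the sum of the displacements of the switching times
(`exists_schedule`).

A moving switching time r solves d_a(r) = -1/γ, and -1/γ - θ behaves like θ²(γ - γ₀). Hence its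
displacement behaves like θ²/|D₁| · (γ - γ₀) if the one-sided first derivative D₁ of d_a is nonzero,
and like √2|θ|/√D₂ · √(γ - γ₀) if D₁ = 0 and D₂ ≠ 0 (`asymptotics_of_level`). Thus Ĵ - J(0) is
exactly the leading term θSφ(γ) of J(γ) - J(0), with φ = γ - γ₀ or φ = √(γ - γ₀), and S > 0 because
the greatest type is attained. The error is o(φ), so it is eventually the smaller of the two
(`eventually_abs_sub_le`). A control determines its schedule (`HasSchedule.unique`), which carries
the result over to every admissible (σ, τ). -/

open Filter Topology

namespace SwitchedSystem

/-! ### Grönwall's inequality and dependence of trajectories on the modes -/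

/-- Grönwall's inequality in integral form. -/
theorem le_mul_exp_of_le_add_integral {T K A : ℝ} (hT : 0 ≤ T) (hK : 0 ≤ K) {z : ℝ → ℝ}
    (hz : ContinuousOn z (Icc 0 T))
    (h : ∀ t ∈ Icc 0 T, z t ≤ A + ∫ s in (0 : ℝ)..t, K * z s) :
    ∀ t ∈ Icc 0 T, z t ≤ A * Real.exp (K * t) := by
  -- Extending `z` by constants makes the integrand continuous on the whole line, so that its
  -- primitive is differentiable at the end points too and the differential form of Grönwall's
  -- inequality applies to `Z`.
  set w : ℝ → ℝ := IccExtend hT ((Icc 0 T).domRestrict z) with hw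
  have hwc : Continuous w := hz.domRestrict.Icc_extend'
  have hwz : ∀ t ∈ Icc 0 T, w t = z t := fun t ht => by
    rw [hw, IccExtend_of_mem hT _ ht]; rfl
  set Z : ℝ → ℝ := fun t => A + ∫ s in (0 : ℝ)..t, K * w s with hZ
  have hZd : ∀ t, HasDerivAt Z (K * w t) t := fun t =>
    ((by fun_prop : Continuous fun s => K * w s).integral_hasStrictDerivAt 0 t).hasDerivAt.const_add A
  have hle : ∀ t ∈ Icc 0 T, w t ≤ Z t := fun t ht => by
    rw [hwz t ht]
    refine (h t ht).trans_eq ?_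
    simp only [hZ]
    congr 1
    refine intervalIntegral.integral_congr fun s hs => ?_
    rw [uIcc_of_le ht.1] at hs
    simp only [hwz s ⟨hs.1, hs.2.trans ht.2⟩]
  have key := le_gronwallBound_of_liminf_deriv_right_le (f := Z) (f' := fun t => K * w t)
    (δ := A) (K := K) (ε := 0) (a := 0) (b := T)
    (fun t _ => (hZd t).continuousAt.continuousWithinAt)
    (fun t _ r hr => (hZd t).hasDerivWithinAt.liminf_right_slope_le hr)
    (by simp [hZ])
    (fun t ht => by
      rw [add_zero]
      exact mul_le_mul_of_nonneg_left (hle t ⟨ht.1, ht.2.le⟩) hK)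
  intro t ht
  have := key t ht
  rw [gronwallBound_ε0, sub_zero] at this
  rw [← hwz t ht]
  exact (hle t ht).trans this

/-- The control that selects the mode `c t` at time `t`. -/
noncomputable def modeControl {N : ℕ} (c : ℝ → Fin N) (t : ℝ) : Fin N → ℝ := Pi.single (c t) 1

theorem field_single {n N : ℕ} (f : Fin N → State n → State n) (y : State n) (a : Fin N) :
    field f y (Pi.single a 1) = f a y := by
  rw [field, Finset.sum_eq_single a] <;> simp +contextual

theorem field_modeControl {n N : ℕ} (f : Fin N → State n → State n) (y : State n)
    (c : ℝ → Fin N) (t : ℝ) : field f y (modeControl c t) = f (c t) y :=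
  field_single f y (c t)

/-- The duration in `[0, T]` of the disagreement between two mode functions. -/
noncomputable def mismatch {N : ℕ} (T : ℝ) (c₁ c₂ : ℝ → Fin N) : ℝ :=
  ∫ s in (0 : ℝ)..T, if c₁ s = c₂ s then 0 else 1

section Trajectory

variable {n N : ℕ} {f g : Fin N → State n → State n} {x₀ : State n} {T : ℝ}
  {v w : ℝ → Fin N → ℝ} {x y : ℝ → State n} {c c₁ c₂ : ℝ → Fin N}

theorem IsTrajectory.continuousOn (hT : 0 ≤ T) (h : IsTrajectory f x₀ T v x) :
    ContinuousOn x (Icc 0 T) := by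
  have := intervalIntegral.continuousOn_primitive_interval' h.integrable (left_mem_uIcc)
  rw [uIcc_of_le hT] at this
  exact (continuousOn_const.add this).congr h.eq

theorem IsTrajectory.congr_ae (hT : 0 ≤ T) (h : IsTrajectory f x₀ T v x)
    (hvw : ∀ᵐ t ∂(volume.restrict (Icc 0 T)), v t = w t) : IsTrajectory f x₀ T w x := by
  have h1 : ∀ᵐ t, t ∈ Icc 0 T → v t = w t := (ae_restrict_iff' measurableSet_Icc).1 hvw
  have hint : ∀ t ∈ Icc 0 T, ∀ᵐ s, s ∈ uIoc 0 t →
      field f (x s) (v s) = field f (x s) (w s) := fun t ht => by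
    filter_upwards [h1] with s hs hs'
    rw [uIoc_of_le ht.1] at hs'
    rw [hs ⟨hs'.1.le, hs'.2.trans ht.2⟩]
  refine ⟨h.integrable.congr_ae ((ae_restrict_iff' measurableSet_uIoc).2
    (hint T (right_mem_Icc.2 hT))), fun t ht => ?_⟩
  rw [h.eq t ht, intervalIntegral.integral_congr_ae (hint t ht)]

/-- Used to pass between the modes and their cut-off versions as long as a trajectory stays where
the two coincide. -/
theorem IsTrajectory.congr_field (hT : 0 ≤ T) (h : IsTrajectory f x₀ T (modeControl c) x)
    (hfg : ∀ t ∈ Icc 0 T, ∀ a, f a (x t) = g a (x t)) :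
    IsTrajectory g x₀ T (modeControl c) x := by
  have hint : ∀ t ∈ Icc 0 T, EqOn (fun s => field f (x s) (modeControl c s))
      (fun s => field g (x s) (modeControl c s)) (uIcc 0 t) := fun t ht s hs => by
    rw [uIcc_of_le ht.1] at hs
    simp only [field_modeControl]
    exact hfg s ⟨hs.1, hs.2.trans ht.2⟩ _
  refine ⟨h.integrable.congr ((hint T (right_mem_Icc.2 hT)).mono uIoc_subset_uIcc), fun t ht => ?_⟩
  rw [h.eq t ht, intervalIntegral.integral_congr (hint t ht)]

theorem measurable_ite_mode (hc₁ : Measurable c₁) (hc₂ : Measurable c₂) :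
    Measurable fun s => if c₁ s = c₂ s then (0 : ℝ) else 1 :=
  Measurable.ite (measurableSet_eq_fun hc₁ hc₂) measurable_const measurable_const

theorem intervalIntegrable_ite_mode (hc₁ : Measurable c₁) (hc₂ : Measurable c₂) (a b : ℝ) :
    IntervalIntegrable (fun s => if c₁ s = c₂ s then (0 : ℝ) else 1) volume a b := by
  refine (intervalIntegrable_const (c := (1 : ℝ))).mono_fun
    (measurable_ite_mode hc₁ hc₂).aestronglyMeasurable (ae_of_all _ fun s => ?_)
  dsimp only
  split_ifs <;> simp

theorem mismatch_nonneg (hT : 0 ≤ T) : 0 ≤ mismatch T c₁ c₂ :=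
  intervalIntegral.integral_nonneg hT fun s _ => by split_ifs <;> simp

theorem integral_ite_mode_le_mismatch (hc₁ : Measurable c₁) (hc₂ : Measurable c₂) {t : ℝ}
    (ht : t ∈ Icc 0 T) :
    ∫ s in (0 : ℝ)..t, (if c₁ s = c₂ s then (0 : ℝ) else 1) ≤ mismatch T c₁ c₂ :=
  intervalIntegral.integral_mono_interval le_rfl ht.1 ht.2
    (ae_of_all _ fun s => by dsimp only; split_ifs <;> simp)
    (intervalIntegrable_ite_mode hc₁ hc₂ 0 T)

/-- Two trajectories along which the modes are Lipschitz and bounded differ by at most a constant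
times the duration of the disagreement of their modes. -/
theorem IsTrajectory.norm_sub_le_mismatch (hT : 0 ≤ T) {S : Set (State n)} {K M : ℝ} (hK : 0 ≤ K)
    (hM : 0 ≤ M)
    (hLip : ∀ a, ∀ y ∈ S, ∀ z ∈ S, ‖f a y - f a z‖ ≤ K * ‖y - z‖)
    (hbd : ∀ a, ∀ y ∈ S, ‖f a y‖ ≤ M) (hc₁ : Measurable c₁) (hc₂ : Measurable c₂)
    (hx : IsTrajectory f x₀ T (modeControl c₁) x) (hy : IsTrajectory f x₀ T (modeControl c₂) y)
    (hxS : ∀ t ∈ Icc 0 T, x t ∈ S) (hyS : ∀ t ∈ Icc 0 T, y t ∈ S) :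
    ∀ t ∈ Icc 0 T, ‖x t - y t‖ ≤ 2 * M * mismatch T c₁ c₂ * Real.exp (K * T) := by
  have hxc := hx.continuousOn hT
  have hyc := hy.continuousOn hT
  have hzc : ContinuousOn (fun t => ‖x t - y t‖) (Icc 0 T) := (hxc.sub hyc).norm
  have key : ∀ t ∈ Icc 0 T, ‖x t - y t‖ ≤
      2 * M * mismatch T c₁ c₂ + ∫ s in (0 : ℝ)..t, K * ‖x s - y s‖ := fun t ht => by
    have hsub : uIcc 0 t ⊆ uIcc 0 T := by
      rw [uIcc_of_le ht.1, uIcc_of_le hT]; exact Icc_subset_Icc_right ht.2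
    have hix := hx.integrable.mono_set hsub
    have hiy := hy.integrable.mono_set hsub
    have hi1 : IntervalIntegrable (fun s => 2 * M * (if c₁ s = c₂ s then (0 : ℝ) else 1))
        volume 0 t := (intervalIntegrable_ite_mode hc₁ hc₂ 0 t).const_mul _
    have hi2 : IntervalIntegrable (fun s => K * ‖x s - y s‖) volume 0 t := by
      refine ContinuousOn.intervalIntegrable ?_
      rw [uIcc_of_le ht.1]
      exact (hzc.mono (Icc_subset_Icc_right ht.2)).const_smul K
    rw [hx.eq t ht, hy.eq t ht, add_sub_add_left_eq_sub,
      ← intervalIntegral.integral_sub hix hiy]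
    calc _ ≤ ∫ s in (0 : ℝ)..t, (2 * M * (if c₁ s = c₂ s then (0 : ℝ) else 1)
            + K * ‖x s - y s‖) := by
          refine intervalIntegral.norm_integral_le_of_norm_le ht.1 (ae_of_all _ fun s hs => ?_)
            (hi1.add hi2)
          have hsT : s ∈ Icc 0 T := ⟨hs.1.le, hs.2.trans ht.2⟩
          rw [field_modeControl, field_modeControl]
          split_ifs with h
          · rw [h]; simpa using hLip _ _ (hxS s hsT) _ (hyS s hsT)
          · have h1 := hbd (c₁ s) _ (hxS s hsT)
            have h2 := hbd (c₂ s) _ (hyS s hsT)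
            have h3 := _root_.norm_sub_le (f (c₁ s) (x s)) (f (c₂ s) (y s))
            have h4 : 0 ≤ K * ‖x s - y s‖ := by positivity
            linarith
      _ ≤ _ := by
          rw [intervalIntegral.integral_add hi1 hi2, intervalIntegral.integral_const_mul]
          gcongr
          exact integral_ite_mode_le_mismatch hc₁ hc₂ ht
  intro t ht
  refine (le_mul_exp_of_le_add_integral hT hK hzc key t ht).trans ?_
  have := mismatch_nonneg (c₁ := c₁) (c₂ := c₂) hT
  gcongr
  exact ht.2

theorem mismatch_self : mismatch T c c = 0 := by simp [mismatch]

end Trajectory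

/-! ### Existence, uniqueness and perturbation of trajectories -/

section Existence

variable {n N : ℕ} {T : ℝ} {c : ℝ → Fin N}

theorem measurable_mode_comp {g : Fin N → State n → State n} (hg : ∀ a, Continuous (g a))
    (hc : Measurable c) {y : ℝ → State n} (hy : Continuous y) :
    Measurable fun s => g (c s) (y s) :=
  (measurable_from_prod_countable_left (f := fun p : State n × Fin N => g p.2 p.1)
    fun a => (hg a).measurable).comp (hy.measurable.prodMk hc)

theorem intervalIntegrable_mode_comp {g : Fin N → State n → State n}
    (hg : ∀ a, Continuous (g a)) {M : ℝ} (hM : ∀ a y, ‖g a y‖ ≤ M)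
    (hc : Measurable c) {y : ℝ → State n} (hy : Continuous y) (a b : ℝ) :
    IntervalIntegrable (fun s => g (c s) (y s)) volume a b :=
  (intervalIntegrable_const (c := M)).mono_fun
    (measurable_mode_comp hg hc hy).aestronglyMeasurable
    (ae_of_all _ fun _ => (hM _ _).trans (le_abs_self M))

/-- Bounded, globally Lipschitz modes have a trajectory on `[0, T]` for every measurable selection
of modes. -/
theorem exists_isTrajectory_of_lipschitz (hT : 0 ≤ T) {g : Fin N → State n → State n}
    (hg : ∀ a, Continuous (g a)) {K M : ℝ} (hK : 0 ≤ K) (hM : ∀ a y, ‖g a y‖ ≤ M)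
    (hLip : ∀ a y z, ‖g a y - g a z‖ ≤ K * ‖y - z‖) (hc : Measurable c) (x₀ : State n) :
    ∃ y, IsTrajectory g x₀ T (modeControl c) y := by
  let ext : C(Icc 0 T, State n) → ℝ → State n := fun y => IccExtend hT y
  have hext : ∀ y, Continuous (ext y) := fun y => y.continuous.Icc_extend'
  have hint : ∀ y a b, IntervalIntegrable (fun s => g (c s) (ext y s)) volume a b :=
    fun y a b => intervalIntegrable_mode_comp hg hM hc (hext y) a b
  let Φ : C(Icc 0 T, State n) → C(Icc 0 T, State n) := fun y =>
    ⟨fun t => x₀ + ∫ s in (0 : ℝ)..t, g (c s) (ext y s),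
      continuous_const.add ((intervalIntegral.continuous_primitive (hint y) 0).comp
        continuous_subtype_val)⟩
  -- Picard iteration: each application of `Φ` integrates the previous estimate once more, which
  -- produces the factorial. Some iterate is then a contraction whatever `K * T` is, and its fixed
  -- point is fixed by `Φ`.
  have key : ∀ y z : C(Icc 0 T, State n), ∀ k : ℕ, ∀ t : Icc 0 T,
      ‖Φ^[k] y t - Φ^[k] z t‖ ≤ dist y z * ((K * t) ^ k / k.factorial) := by
    intro y z k
    induction k with
    | zero => intro t; simpa [dist_eq_norm] using ContinuousMap.dist_apply_le_dist (f := y) (g := z) t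
    | succ k ih =>
      intro t
      rw [Function.iterate_succ_apply', Function.iterate_succ_apply']
      set y' := Φ^[k] y
      set z' := Φ^[k] z
      have h0 : Φ y' t - Φ z' t =
          ∫ s in (0 : ℝ)..t, (g (c s) (ext y' s) - g (c s) (ext z' s)) := by
        rw [intervalIntegral.integral_sub (hint _ _ _) (hint _ _ _)]
        exact add_sub_add_left_eq_sub _ _ _
      rw [h0]
      have h1 : ∀ s ∈ Ioc (0 : ℝ) t, ‖g (c s) (ext y' s) - g (c s) (ext z' s)‖ ≤
          K * (dist y z * ((K * s) ^ k / k.factorial)) := fun s hs => by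
        refine (hLip _ _ _).trans (mul_le_mul_of_nonneg_left ?_ hK)
        have hsT : s ∈ Icc 0 T := ⟨hs.1.le, hs.2.trans t.2.2⟩
        simp only [ext, IccExtend_of_mem hT _ hsT]
        exact ih ⟨s, hsT⟩
      refine (intervalIntegral.norm_integral_le_of_norm_le t.2.1 (ae_of_all _ h1)
        (Continuous.intervalIntegrable (by fun_prop) _ _)).trans_eq ?_
      have h2 : (fun s : ℝ => K * (dist y z * ((K * s) ^ k / k.factorial))) =
          fun s => (K * dist y z * K ^ k / k.factorial) * s ^ k := by
        funext s; rw [mul_pow]; ring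
      rw [h2, intervalIntegral.integral_const_mul, integral_pow, Nat.factorial_succ]
      have : (k.factorial : ℝ) ≠ 0 := by positivity
      push_cast
      field_simp
      ring
  obtain ⟨k, hk⟩ := ((FloorSemiring.tendsto_pow_div_factorial_atTop (K * T)).eventually
    (gt_mem_nhds (show (0 : ℝ) < 1 / 2 by norm_num))).exists
  have hcontr : ContractingWith (1 / 2) Φ^[k] := by
    refine ⟨by rw [← NNReal.coe_lt_coe]; norm_num, LipschitzWith.of_dist_le_mul fun y z => ?_⟩
    rw [ContinuousMap.dist_le (by positivity)]
    intro t
    rw [dist_eq_norm]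
    refine (key y z k t).trans ?_
    rw [mul_comm]
    refine mul_le_mul_of_nonneg_right (le_trans ?_ (hk.le.trans_eq (by simp))) dist_nonneg
    have := t.2.1
    have := t.2.2
    gcongr
  have hfix := hcontr.isFixedPt_fixedPoint_iterate
  set y := hcontr.fixedPoint Φ^[k]
  refine ⟨ext y, by simpa only [field_modeControl] using hint y 0 T, fun t ht => ?_⟩
  simp only [field_modeControl]
  have h1 : ext y t = y ⟨t, ht⟩ := IccExtend_of_mem hT _ ht
  rw [h1]
  conv_lhs => rw [← hfix]
  rfl

/-- A trajectory persists under changes of the modes during a short time, and the perturbation is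
at most proportional to that time. -/
theorem IsTrajectory.exists_perturbation (hT : 0 ≤ T) {f : Fin N → State n → State n}
    (hf : ∀ a, ContDiff ℝ 1 (f a)) {x₀ : State n} {x : ℝ → State n} {c₀ : ℝ → Fin N}
    (hc₀ : Measurable c₀) (hx : IsTrajectory f x₀ T (modeControl c₀) x) :
    ∃ ε > 0, ∃ C ≥ 0, ∀ c : ℝ → Fin N, Measurable c → mismatch T c c₀ ≤ ε →
      (∃ y, IsTrajectory f x₀ T (modeControl c) y) ∧
      ∀ y, IsTrajectory f x₀ T (modeControl c) y →
        ∀ t ∈ Icc 0 T, ‖y t - x t‖ ≤ C * mismatch T c c₀ := by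
  obtain ⟨R, hR⟩ := (isCompact_Icc.image_of_continuousOn (hx.continuousOn hT)).isBounded.subset_closedBall 0
  have hxR : ∀ t ∈ Icc 0 T, x t ∈ Metric.closedBall 0 R := fun t ht => hR (mem_image_of_mem x ht)
  have hR0 : 0 ≤ R := by
    have := hxR 0 (left_mem_Icc.2 hT)
    exact (dist_nonneg).trans (Metric.mem_closedBall.1 this)
  -- The modes need not be globally Lipschitz or bounded, since only their second derivatives are
  -- bounded. The cut-off makes them so and leaves a neighbourhood of radius 1 around the values of
  -- `x` untouched.
  let χ : ContDiffBump (0 : State n) := ⟨R + 1, R + 2, by linarith, by linarith⟩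
  let g : Fin N → State n → State n := fun a y => χ y • f a y
  have hgc : ∀ a, ContDiff ℝ 1 (g a) := fun a => χ.contDiff.smul (hf a)
  have hgs : ∀ a, HasCompactSupport (g a) := fun a => χ.hasCompactSupport.smul_right
  have hgf : ∀ y ∈ Metric.closedBall (0 : State n) (R + 1), ∀ a, g a y = f a y := fun y hy a => by
    simp only [g]
    rw [χ.one_of_mem_closedBall hy, one_smul]
  choose K hK using fun a => (hgc a).lipschitzWith_of_hasCompactSupport (hgs a) one_ne_zero
  choose M hM using fun a => (hgs a).exists_bound_of_continuous (hgc a).continuous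
  obtain ⟨K', hK'⟩ : ∃ K' : ℝ, ∀ a, (K a : ℝ) ≤ K' :=
    ⟨∑ a, (K a : ℝ), fun a => Finset.single_le_sum (fun b _ => (K b).2) (Finset.mem_univ a)⟩
  obtain ⟨M', hM'⟩ : ∃ M' : ℝ, ∀ a, M a ≤ M' := by
    refine ⟨∑ a, |M a|, fun a => (le_abs_self _).trans
      (Finset.single_le_sum (f := fun b => |M b|) (fun b _ => abs_nonneg (M b)) (Finset.mem_univ a))⟩
  have a₀ : Fin N := c₀ 0
  have hK'0 : 0 ≤ K' := (K a₀).2.trans (hK' a₀)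
  have hM'0 : 0 ≤ M' := (norm_nonneg _).trans ((hM a₀ 0).trans (hM' a₀))
  have hgL : ∀ a y z, ‖g a y - g a z‖ ≤ K' * ‖y - z‖ := fun a y z => by
    have := (hK a).dist_le_mul y z
    rw [dist_eq_norm, dist_eq_norm] at this
    exact this.trans (mul_le_mul_of_nonneg_right (hK' a) (norm_nonneg _))
  have hgM : ∀ a y, ‖g a y‖ ≤ M' := fun a y => (hM a y).trans (hM' a)
  have hxg : IsTrajectory g x₀ T (modeControl c₀) x := hx.congr_field hT fun t ht a =>
    (hgf _ (Metric.closedBall_subset_closedBall (by linarith) (hxR t ht)) a).symm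
  set C := 2 * M' * Real.exp (K' * T) with hC
  have hC0 : 0 ≤ C := by positivity
  -- With this bound on the mismatch, `C * mismatch` is at most 1, so the perturbed trajectory stays
  -- where the cut-off equals 1.
  refine ⟨1 / (C + 1), by positivity, C, hC0, fun c hc hmis => ?_⟩
  obtain ⟨y, hy⟩ := exists_isTrajectory_of_lipschitz hT (fun a => (hgc a).continuous) hK'0 hgM hgL hc x₀
  have hyx : ∀ t ∈ Icc 0 T, ‖y t - x t‖ ≤ C * mismatch T c c₀ := fun t ht => by
    refine (hy.norm_sub_le_mismatch hT (S := univ) hK'0 hM'0 (fun a y _ z _ => hgL a y z)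
      (fun a y _ => hgM a y) hc hc₀ hxg (fun _ _ => mem_univ _) (fun _ _ => mem_univ _) t ht).trans_eq ?_
    rw [hC]; ring
  have hyR : ∀ t ∈ Icc 0 T, y t ∈ Metric.closedBall (0 : State n) (R + 1) := fun t ht => by
    have h1 : C * mismatch T c c₀ ≤ 1 := by
      calc C * mismatch T c c₀ ≤ C * (1 / (C + 1)) := by gcongr
        _ ≤ 1 := by rw [mul_one_div, div_le_one (by positivity)]; linarith
    have h2 := hxR t ht
    rw [mem_closedBall_zero_iff] at h2 ⊢
    have h3 := norm_le_norm_add_norm_sub (x t) (y t)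
    rw [norm_sub_rev] at h3
    have := hyx t ht
    linarith
  have hyf : IsTrajectory f x₀ T (modeControl c) y := hy.congr_field hT fun t ht a => hgf _ (hyR t ht) a
  refine ⟨⟨y, hyf⟩, fun y' hy' t ht => ?_⟩
  -- An arbitrary trajectory of `f` might leave the ball of radius `R + 1`. Uniqueness excludes
  -- this: on a ball containing both trajectories the modes are Lipschitz and bounded, and the two
  -- mode functions have no mismatch.
  suffices y' t = y t by rw [this]; exact hyx t ht
  obtain ⟨R', hR'⟩ := (isCompact_Icc.image_of_continuousOn (hy'.continuousOn hT)).isBounded.subset_closedBall 0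
  set S := Metric.closedBall (0 : State n) (max R' (R + 1))
  have hSc : IsCompact S := isCompact_closedBall _ _
  have hLS : ∀ a, ∃ k : NNReal, LipschitzOnWith k (f a) S := fun a =>
    (hf a).contDiffOn.exists_lipschitzOnWith one_ne_zero (convex_closedBall _ _) hSc
  choose k hk using hLS
  have hBS : ∀ a, ∃ B, ∀ y ∈ S, ‖f a y‖ ≤ B := fun a =>
    hSc.exists_bound_of_continuousOn (hf a).continuous.continuousOn
  choose B hB using hBS
  have := hy'.norm_sub_le_mismatch hT (S := S) (K := ∑ a, (k a : ℝ)) (M := ∑ a, |B a|)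
    (by positivity) (by positivity) (fun a p hp q hq => by
      have := (hk a).dist_le_mul p hp q hq
      rw [dist_eq_norm, dist_eq_norm] at this
      exact this.trans (mul_le_mul_of_nonneg_right
        (Finset.single_le_sum (f := fun b => (k b : ℝ)) (fun b _ => (k b).2) (Finset.mem_univ a))
        (norm_nonneg _)))
    (fun a p hp => (hB a p hp).trans ((le_abs_self _).trans
      (Finset.single_le_sum (f := fun b => |B b|) (fun b _ => abs_nonneg (B b)) (Finset.mem_univ a))))
    hc hc hyf
    (fun t ht => Metric.closedBall_subset_closedBall (le_max_left _ _) (hR' (mem_image_of_mem y' ht)))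
    (fun t ht => Metric.closedBall_subset_closedBall (le_max_right _ _) (hyR t ht)) t ht
  rw [mismatch_self, mul_zero, zero_mul] at this
  exact sub_eq_zero.1 (norm_le_zero_iff.1 this)

end Existence

/-! ### Active modes and uniqueness of mode schedules -/

section Schedule

variable {N m : ℕ} {σ : Fin (m + 1) → Fin N} {τ : Fin m → ℝ} {T : ℝ}

theorem single_one_inj {a b : Fin N} : (Pi.single a 1 : Fin N → ℝ) = Pi.single b 1 ↔ a = b := by
  refine ⟨fun h => ?_, fun h => h ▸ rfl⟩
  by_contra hab
  have := congrFun h a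
  rw [Pi.single_eq_same, Pi.single_eq_of_ne hab] at this
  exact one_ne_zero this

theorem activeMode_eq {t : ℝ} {k : Fin (m + 1)}
    (h : (Finset.univ.filter fun i => τ i ≤ t).card = k) : activeMode σ τ t = σ k := by
  rw [activeMode]; congr 1; exact Fin.ext h

theorem activeMode_congr {s t : ℝ} (h : ∀ i, τ i ≤ s ↔ τ i ≤ t) :
    activeMode σ τ s = activeMode σ τ t := by
  simp only [activeMode, h]

theorem measurable_activeMode : Measurable (activeMode σ τ) := by
  have hmono : Monotone fun t : ℝ => (⟨(Finset.univ.filter fun i => τ i ≤ t).card,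
      Nat.lt_succ_of_le ((Finset.card_le_univ _).trans (Fintype.card_fin m).le)⟩ : Fin (m + 1)) :=
    fun s t hst => Fin.mk_le_mk.2 (Finset.card_le_card fun i => by
      simp only [Finset.mem_filter, Finset.mem_univ, true_and]; exact fun h => h.trans hst)
  exact (measurable_of_finite σ).comp hmono.measurable

theorem eventually_activeMode_eq {t : ℝ} (ht : t ∉ range τ) :
    ∀ᶠ s in 𝓝 t, activeMode σ τ s = activeMode σ τ t := by
  have : ∀ᶠ s in 𝓝 t, ∀ i, (τ i ≤ s ↔ τ i ≤ t) := by
    refine eventually_all.2 fun i => ?_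
    rcases lt_trichotomy (τ i) t with h | h | h
    · filter_upwards [lt_mem_nhds h] with s hs
      exact ⟨fun _ => h.le, fun _ => hs.le⟩
    · exact absurd ⟨i, h⟩ ht
    · filter_upwards [gt_mem_nhds h] with s hs
      exact ⟨fun h' => absurd h' hs.not_ge, fun h' => absurd h' h.not_ge⟩
  filter_upwards [this] with s hs using activeMode_congr hs

theorem eventually_activeMode_right (hτ : StrictMono τ) (i : Fin m) :
    ∀ᶠ s in 𝓝[>] τ i, activeMode σ τ s = σ i.succ := by
  have : ∀ᶠ s in 𝓝[>] τ i, ∀ j, (τ j ≤ s ↔ j ≤ i) := by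
    refine eventually_all.2 fun j => ?_
    rcases le_or_gt j i with h | h
    · filter_upwards [self_mem_nhdsWithin] with s hs
      exact ⟨fun _ => h, fun _ => (hτ.monotone h).trans (mem_Ioi.1 hs).le⟩
    · filter_upwards [nhdsWithin_le_nhds (gt_mem_nhds (hτ h))] with s hs
      exact ⟨fun h' => absurd h' hs.not_ge, fun h' => absurd h' h.not_ge⟩
  filter_upwards [this] with s hs
  refine activeMode_eq ?_
  simp only [hs]
  rw [show (Finset.univ.filter fun j => j ≤ i) = Finset.Iic i by ext; simp, Fin.card_Iic]
  rfl

theorem eventually_activeMode_left (hτ : StrictMono τ) (i : Fin m) :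
    ∀ᶠ s in 𝓝[<] τ i, activeMode σ τ s = σ i.castSucc := by
  have : ∀ᶠ s in 𝓝[<] τ i, ∀ j, (τ j ≤ s ↔ j < i) := by
    refine eventually_all.2 fun j => ?_
    rcases lt_or_ge j i with h | h
    · filter_upwards [nhdsWithin_le_nhds (lt_mem_nhds (hτ h))] with s hs
      exact ⟨fun _ => h, fun _ => hs.le⟩
    · filter_upwards [self_mem_nhdsWithin] with s hs
      exact ⟨fun h' => absurd (h'.trans_lt hs) (hτ.monotone h).not_gt, fun h' => absurd h' h.not_gt⟩
  filter_upwards [this] with s hs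
  refine activeMode_eq ?_
  simp only [hs]
  rw [show (Finset.univ.filter fun j => j < i) = Finset.Iio i by ext; simp, Fin.card_Iio]
  rfl

theorem activeMode_of_forall_gt {t : ℝ} (h : ∀ i, t < τ i) : activeMode σ τ t = σ 0 := by
  refine activeMode_eq ?_
  rw [Finset.filter_false_of_mem fun i _ => (h i).not_ge]
  rfl

theorem activeMode_of_forall_le {t : ℝ} (h : ∀ i, τ i ≤ t) :
    activeMode σ τ t = σ (Fin.last m) := by
  refine activeMode_eq ?_
  rw [Finset.filter_true_of_mem fun i _ => h i]
  simp

/-- A switching time later than `t` is not counted at time `t`. This lets schedules be built from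
left to right. -/
theorem activeMode_snoc {t b : ℝ} {a : Fin N} (ht : t < b) :
    activeMode (Fin.snoc σ a : Fin (m + 1 + 1) → Fin N) (Fin.snoc τ b : Fin (m + 1) → ℝ) t =
      activeMode σ τ t := by
  have hk : (Finset.univ.filter fun i => (Fin.snoc τ b : Fin (m + 1) → ℝ) i ≤ t).card =
      (Finset.univ.filter fun i => τ i ≤ t).card := by
    rw [Finset.card_filter, Finset.card_filter, Fin.sum_univ_castSucc]
    simp [ht.not_ge]
  have hlt : (Finset.univ.filter fun i => τ i ≤ t).card < m + 1 :=
    Nat.lt_succ_of_le ((Finset.card_le_univ _).trans (Fintype.card_fin m).le)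
  rw [activeMode_eq (σ := (Fin.snoc σ a : Fin (m + 1 + 1) → Fin N))
    (k := Fin.castSucc ⟨_, hlt⟩) hk, Fin.snoc_castSucc]
  rfl

/-- Functions that are constant on the right of a point of `[0, T)` and agree almost everywhere
have the same constant. -/
theorem eq_of_eventually_right {α : Type*} {p q : ℝ → α} {t : ℝ} {a b : α} (ht : t ∈ Ico 0 T)
    (hpq : ∀ᵐ s ∂(volume.restrict (Icc 0 T)), p s = q s) (hp : ∀ᶠ s in 𝓝[>] t, p s = a)
    (hq : ∀ᶠ s in 𝓝[>] t, q s = b) : a = b := by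
  obtain ⟨r, hr, hr'⟩ := mem_nhdsGT_iff_exists_Ioo_subset.1 ((hp.and hq).and (Ioo_mem_nhdsGT ht.2))
  have hr0 : t < r := hr
  have h1 : ∀ᵐ s, s ∈ Icc 0 T → p s = q s := (ae_restrict_iff' measurableSet_Icc).1 hpq
  -- The interval has positive length, so it is not contained in the exceptional null set.
  have h2 : ∃ s ∈ Ioo t r, s ∈ Icc 0 T → p s = q s := by
    by_contra! hcon
    have : volume (Ioo t r) ≤ 0 := by
      rw [← (ae_iff.1 h1)]
      exact measure_mono fun s hs => by
        have := hcon s hs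
        simp only [mem_ofPred_eq]
        exact fun h => this.2 (h this.1)
    rw [Real.volume_Ioo] at this
    simp at this
    linarith
  obtain ⟨s, hs, hs'⟩ := h2
  obtain ⟨⟨h3, h4⟩, h5⟩ := hr' hs
  rw [← h3, ← h4]
  exact hs' ⟨ht.1.trans h5.1.le, h5.2.le⟩

/-- Functions that are constant on the left of a point of `(0, T]` and agree almost everywhere
have the same constant. -/
theorem eq_of_eventually_left {α : Type*} {p q : ℝ → α} {t : ℝ} {a b : α} (ht : t ∈ Ioc 0 T)
    (hpq : ∀ᵐ s ∂(volume.restrict (Icc 0 T)), p s = q s) (hp : ∀ᶠ s in 𝓝[<] t, p s = a)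
    (hq : ∀ᶠ s in 𝓝[<] t, q s = b) : a = b := by
  obtain ⟨r, hr, hr'⟩ := mem_nhdsLT_iff_exists_Ioo_subset.1 ((hp.and hq).and (Ioo_mem_nhdsLT ht.1))
  have hr0 : r < t := hr
  have h1 : ∀ᵐ s, s ∈ Icc 0 T → p s = q s := (ae_restrict_iff' measurableSet_Icc).1 hpq
  have h2 : ∃ s ∈ Ioo r t, s ∈ Icc 0 T → p s = q s := by
    by_contra! hcon
    have : volume (Ioo r t) ≤ 0 := by
      rw [← (ae_iff.1 h1)]
      exact measure_mono fun s hs => by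
        have := hcon s hs
        simp only [mem_ofPred_eq]
        exact fun h => this.2 (h this.1)
    rw [Real.volume_Ioo] at this
    simp at this
    linarith
  obtain ⟨s, hs, hs'⟩ := h2
  obtain ⟨⟨h3, h4⟩, h5⟩ := hr' hs
  rw [← h3, ← h4]
  exact hs' ⟨h5.1.le, h5.2.le.trans ht.2⟩

theorem HasSchedule.activeMode_ae {v : ℝ → Fin N → ℝ} (h : HasSchedule T σ τ v) {m' : ℕ}
    {σ' : Fin (m' + 1) → Fin N} {τ' : Fin m' → ℝ} (h' : HasSchedule T σ' τ' v) :
    ∀ᵐ s ∂(volume.restrict (Icc 0 T)), activeMode σ τ s = activeMode σ' τ' s := by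
  filter_upwards [h.2, h'.2] with s h1 h2
  exact single_one_inj.1 (h1.symm.trans h2)

/-- If a switching time of the first schedule were not one of the second, the second mode would be
constant around it. The two neighbouring modes of the first schedule would then both equal this
constant, but consecutive modes are distinct. -/
theorem HasSchedule.range_subset {v : ℝ → Fin N → ℝ} (h : HasSchedule T σ τ v) {m' : ℕ}
    {σ' : Fin (m' + 1) → Fin N} {τ' : Fin m' → ℝ} (h' : HasSchedule T σ' τ' v) :
    range τ ⊆ range τ' := by
  rintro _ ⟨i, rfl⟩
  by_contra hi
  have hae := h.activeMode_ae h'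
  have hmem := h.1.mem_Ioo i
  have hc := eventually_activeMode_eq (σ := σ') hi
  have h1 := eq_of_eventually_right ⟨hmem.1.le, hmem.2⟩ hae
    (eventually_activeMode_right h.1.strictMono i) (nhdsWithin_le_nhds hc)
  have h2 := eq_of_eventually_left ⟨hmem.1, hmem.2.le⟩ hae
    (eventually_activeMode_left h.1.strictMono i) (nhdsWithin_le_nhds hc)
  exact h.1.mode_ne i (h2.trans h1.symm)

/-- The number of switching times of a control is determined by the control. -/
theorem HasSchedule.length_eq {v : ℝ → Fin N → ℝ} (h : HasSchedule T σ τ v) {m' : ℕ}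
    {σ' : Fin (m' + 1) → Fin N} {τ' : Fin m' → ℝ} (h' : HasSchedule T σ' τ' v) : m = m' := by
  have h1 := (h.range_subset h').antisymm (h'.range_subset h)
  have h2 := congrArg Set.ncard h1
  rwa [← image_univ, ← image_univ, ncard_image_of_injective _ h.1.strictMono.injective,
    ncard_image_of_injective _ h'.1.strictMono.injective, ncard_univ, ncard_univ,
    Nat.card_eq_fintype_card, Nat.card_eq_fintype_card, Fintype.card_fin, Fintype.card_fin] at h2

/-- The mode schedule of a control is determined by the control. -/
theorem HasSchedule.unique {v : ℝ → Fin N → ℝ} (hT : 0 < T) (h : HasSchedule T σ τ v)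
    {σ' : Fin (m + 1) → Fin N} {τ' : Fin m → ℝ} (h' : HasSchedule T σ' τ' v) :
    σ = σ' ∧ τ = τ' := by
  have hτ : τ = τ' := (h.1.strictMono.range_inj h'.1.strictMono).1
    ((h.range_subset h').antisymm (h'.range_subset h))
  subst hτ
  refine ⟨?_, rfl⟩
  have hae := h.activeMode_ae h'
  funext k
  refine Fin.cases ?_ (fun i => ?_) k
  · have h0 : ∀ᶠ s in 𝓝[>] (0 : ℝ), ∀ i, s < τ i :=
      eventually_all.2 fun i => nhdsWithin_le_nhds (gt_mem_nhds (h.1.mem_Ioo i).1)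
    exact eq_of_eventually_right ⟨le_rfl, hT⟩ hae (h0.mono fun s hs => activeMode_of_forall_gt hs)
      (h0.mono fun s hs => activeMode_of_forall_gt hs)
  · have hmem := h.1.mem_Ioo i
    exact eq_of_eventually_right ⟨hmem.1.le, hmem.2⟩ hae
      (eventually_activeMode_right h.1.strictMono i) (eventually_activeMode_right h.1.strictMono i)

end Schedule

/-! ### First-order expansion of the cost -/

section Cost

variable {n N : ℕ} {T : ℝ} {c : ℝ → Fin N}

/-- There are finitely many modes, so the integrand is a finite sum of continuous functions
multiplied by indicators of measurable sets. -/
theorem intervalIntegrable_mode {F : Type*} [NormedAddCommGroup F] (hT : 0 ≤ T)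
    (hc : Measurable c) {φ : Fin N → ℝ → F} (hφ : ∀ a, ContinuousOn (φ a) (Icc 0 T)) :
    IntervalIntegrable (fun t => φ (c t) t) volume 0 T := by
  rw [intervalIntegrable_iff_integrableOn_Icc_of_le hT]
  have : (fun t => φ (c t) t) = fun t => ∑ a, (c ⁻¹' {a}).indicator (φ a) t := by
    funext t
    rw [Finset.sum_eq_single (c t)]
    · simp
    · intro b _ hb
      have : t ∉ c ⁻¹' {b} := by simpa using hb.symm
      exact indicator_of_notMem this _
    · simp
  rw [this]
  exact integrable_finsetSum _ fun a _ =>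
    ((hφ a).integrableOn_Icc).indicator (hc (measurableSet_singleton a))

theorem IsTrajectory.hasDerivAt {f : Fin N → State n → State n} (hf : ∀ a, Continuous (f a))
    {x₀ : State n} {y : ℝ → State n} (hy : IsTrajectory f x₀ T (modeControl c) y) {t : ℝ}
    (ht : t ∈ Ioo 0 T) (hct : ∀ᶠ s in 𝓝 t, c s = c t) : HasDerivAt y (f (c t) (y t)) t := by
  have hT : 0 ≤ T := (ht.1.trans ht.2).le
  have hnhds : Icc 0 T ∈ 𝓝 t := Icc_mem_nhds ht.1 ht.2
  have hyc : ContinuousAt y t := (hy.continuousOn hT).continuousAt hnhds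
  have hcont : ContinuousAt (fun s => field f (y s) (modeControl c s)) t := by
    have h1 : ContinuousAt (fun s => f (c t) (y s)) t := (hf _).continuousAt.comp hyc
    refine h1.congr ?_
    filter_upwards [hct] with s hs
    rw [field_modeControl, hs]
  have hsub : uIcc 0 t ⊆ uIcc 0 T := by
    rw [uIcc_of_le ht.1.le, uIcc_of_le hT]; exact Icc_subset_Icc_right ht.2.le
  have hd := intervalIntegral.integral_hasDerivAt_right (hy.integrable.mono_set hsub)
    ⟨Ioc 0 T, Ioc_mem_nhds ht.1 ht.2, hy.integrable.1.aestronglyMeasurable⟩ hcont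
  rw [field_modeControl] at hd
  refine (hd.const_add x₀).congr_of_eventuallyEq ?_
  filter_upwards [hnhds] with s hs using hy.eq s hs

/-- Quadratic bound on the remainder of the first-order expansion of a function with bounded
second derivative. -/
theorem norm_sub_sub_fderiv_le {E F : Type*} [NormedAddCommGroup E] [NormedSpace ℝ E]
    [NormedAddCommGroup F] [NormedSpace ℝ F] {g : E → F} (hg : ContDiff ℝ 2 g) {K : ℝ}
    (hK : ∀ y, ‖iteratedFDeriv ℝ 2 g y‖ ≤ K) (x y : E) :
    ‖g y - g x - fderiv ℝ g x (y - x)‖ ≤ K * ‖y - x‖ ^ 2 := by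
  have hK0 : 0 ≤ K := (norm_nonneg _).trans (hK x)
  have hg1 : ContDiff ℝ 1 (fderiv ℝ g) := hg.fderiv_right (by norm_num)
  have hLip : ∀ z, ‖fderiv ℝ g z - fderiv ℝ g x‖ ≤ K * ‖z - x‖ := fun z =>
    convex_univ.norm_image_sub_le_of_norm_fderiv_le
      (fun w _ => (hg1.differentiable one_ne_zero) w)
      (fun w _ => by
        rw [← norm_iteratedFDeriv_one, norm_iteratedFDeriv_fderiv]; exact hK w)
      (mem_univ x) (mem_univ z)
  have := (convex_segment x y).norm_image_sub_le_of_norm_hasFDerivWithin_le'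
    (f := g) (f' := fderiv ℝ g) (φ := fderiv ℝ g x) (C := K * ‖y - x‖)
    (fun z _ => ((hg.differentiable two_ne_zero) z).hasFDerivAt.hasFDerivWithinAt)
    (fun z hz => (hLip z).trans (mul_le_mul_of_nonneg_left (norm_sub_le_of_mem_segment hz) hK0))
    (left_mem_segment ℝ x y) (right_mem_segment ℝ x y)
  rwa [mul_assoc, ← sq] at this

theorem exists_bound_finite {E F : Type*} [TopologicalSpace E] [SeminormedAddCommGroup F]
    {S : Set E} (hS : IsCompact S) (φ : Fin N → E → F) (hφ : ∀ a, ContinuousOn (φ a) S) :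
    ∃ B ≥ 0, ∀ a, ∀ t ∈ S, ‖φ a t‖ ≤ B := by
  choose B hB using fun a => hS.exists_bound_of_continuousOn (hφ a)
  exact ⟨∑ a, |B a|, by positivity, fun a t ht => (hB a t ht).trans ((le_abs_self _).trans
    (Finset.single_le_sum (f := fun b => |B b|) (fun b _ => abs_nonneg (B b))
      (Finset.mem_univ a)))⟩

/-- First-order expansion of the cost under needle variations, with a quadratic remainder in the
duration of the variation. -/
theorem exists_cost_expansion (hT : 0 ≤ T) {f : Fin N → State n → State n} {ℓ : State n → ℝ}
    (hf : ∀ a, ContDiff ℝ 2 (f a)) (hℓ : ContDiff ℝ 2 ℓ)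
    (hfb : ∃ K : ℝ, ∀ a y, ‖iteratedFDeriv ℝ 2 (f a) y‖ ≤ K)
    (hℓb : ∃ K : ℝ, ∀ y, ‖iteratedFDeriv ℝ 2 ℓ y‖ ≤ K) {x₀ : State n} {m₀ : ℕ}
    {σ₀ : Fin (m₀ + 1) → Fin N} {τ₀ : Fin m₀ → ℝ} {x ρ : ℝ → State n}
    (hx : IsTrajectory f x₀ T (scheduleControl σ₀ τ₀) x) (hρ : IsAdjoint f ℓ T σ₀ τ₀ x ρ) :
    ∃ ε > 0, ∃ C ≥ 0, ∀ (m : ℕ) (σ : Fin (m + 1) → Fin N) (τ : Fin m → ℝ),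
      mismatch T (activeMode σ τ) (activeMode σ₀ τ₀) ≤ ε →
      (∃ y, IsTrajectory f x₀ T (scheduleControl σ τ) y) ∧
      ∀ y, IsTrajectory f x₀ T (scheduleControl σ τ) y →
        |(∫ s in (0 : ℝ)..T, ℓ (y s)) - (∫ s in (0 : ℝ)..T, ℓ (x s)) -
          ∫ s in (0 : ℝ)..T, inner ℝ (ρ s)
            (f (activeMode σ τ s) (x s) - f (activeMode σ₀ τ₀ s) (x s))| ≤
          C * mismatch T (activeMode σ τ) (activeMode σ₀ τ₀) ^ 2 := by
  obtain ⟨Kf, hKf⟩ := hfb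
  obtain ⟨Kℓ, hKℓ⟩ := hℓb
  set c₀ := activeMode σ₀ τ₀
  have hc₀ : Measurable c₀ := measurable_activeMode
  obtain ⟨ε, hε, C, hC, H⟩ := hx.exists_perturbation hT (fun a => (hf a).of_le (by norm_num)) hc₀
  have hxc := hx.continuousOn hT
  have hρc := hρ.continuousOn
  have hDc : ∀ a, ContinuousOn (fun t => fderiv ℝ (f a) (x t)) (Icc 0 T) := fun a =>
    ((hf a).continuous_fderiv two_ne_zero).comp_continuousOn hxc
  have hgc : ContinuousOn (fun t => fderiv ℝ ℓ (x t)) (Icc 0 T) :=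
    (hℓ.continuous_fderiv two_ne_zero).comp_continuousOn hxc
  obtain ⟨L, hL0, hL⟩ := exists_bound_finite isCompact_Icc _ hDc
  obtain ⟨P, hP⟩ := isCompact_Icc.exists_bound_of_continuousOn hρc
  have hP0 : 0 ≤ P := (norm_nonneg _).trans (hP 0 (left_mem_Icc.2 hT))
  have hKf0 : 0 ≤ Kf := (norm_nonneg _).trans (hKf (c₀ 0) 0)
  have hKℓ0 : 0 ≤ Kℓ := (norm_nonneg _).trans (hKℓ 0)
  refine ⟨ε, hε, (Kℓ + P * Kf) * C ^ 2 * T + 2 * P * L * C, by positivity, fun m σ τ hmis => ?_⟩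
  set c := activeMode σ τ
  have hc : Measurable c := measurable_activeMode
  obtain ⟨hex, hcl⟩ := H c hc hmis
  refine ⟨hex, fun y hy => ?_⟩
  have hyx := hcl y hy
  have hyc := hy.continuousOn hT
  set ε' := mismatch T c c₀
  have hε' : 0 ≤ ε' := mismatch_nonneg hT
  have hzc : ContinuousOn (fun t => y t - x t) (Icc 0 T) := hyc.sub hxc
  have hcomp : ∀ a, ∀ {w : ℝ → State n}, ContinuousOn w (Icc 0 T) →
      ContinuousOn (fun t => f a (w t)) (Icc 0 T) := fun a w hw =>
    (hf a).continuous.comp_continuousOn hw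
  have iA : IntervalIntegrable (fun t => inner ℝ (ρ t) (f (c t) (y t))) volume 0 T :=
    intervalIntegrable_mode hT hc (φ := fun a t => inner ℝ (ρ t) (f a (y t)))
      fun a => hρc.inner (hcomp a hyc)
  have iA' : IntervalIntegrable (fun t => inner ℝ (ρ t) (f (c t) (x t))) volume 0 T :=
    intervalIntegrable_mode hT hc (φ := fun a t => inner ℝ (ρ t) (f a (x t)))
      fun a => hρc.inner (hcomp a hxc)
  have iB : IntervalIntegrable (fun t => inner ℝ (ρ t) (f (c₀ t) (x t))) volume 0 T :=
    intervalIntegrable_mode hT hc₀ (φ := fun a t => inner ℝ (ρ t) (f a (x t)))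
      fun a => hρc.inner (hcomp a hxc)
  have iD : IntervalIntegrable (fun t => inner ℝ (ρ t) (fderiv ℝ (f (c₀ t)) (x t) (y t - x t)))
      volume 0 T :=
    intervalIntegrable_mode hT hc₀
      (φ := fun a t => inner ℝ (ρ t) (fderiv ℝ (f a) (x t) (y t - x t)))
      fun a => hρc.inner ((hDc a).clm_apply hzc)
  have iG : IntervalIntegrable (fun t => fderiv ℝ ℓ (x t) (y t - x t)) volume 0 T := by
    refine ContinuousOn.intervalIntegrable ?_
    rw [uIcc_of_le hT]
    exact hgc.clm_apply hzc
  have iℓ : ∀ {w : ℝ → State n}, ContinuousOn w (Icc 0 T) →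
      IntervalIntegrable (fun t => ℓ (w t)) volume 0 T := fun hw => by
    refine ContinuousOn.intervalIntegrable ?_
    rw [uIcc_of_le hT]
    exact hℓ.continuous.comp_continuousOn hw
  -- This is the derivative of ⟨ρ, y - x⟩ away from the switching times of both schedules. Its
  -- integral vanishes because y(0) = x(0) and ρ(T) = 0, so it can be added to the integrand of the
  -- remainder, where it cancels the linear term of ℓ.
  set h' : ℝ → ℝ := fun t => inner ℝ (ρ t) (f (c t) (y t)) - inner ℝ (ρ t) (f (c₀ t) (x t)) -
    inner ℝ (ρ t) (fderiv ℝ (f (c₀ t)) (x t) (y t - x t)) - fderiv ℝ ℓ (x t) (y t - x t) with hh'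
  have ih' : IntervalIntegrable h' volume 0 T := ((iA.sub iB).sub iD).sub iG
  have hzero : ∫ t in (0 : ℝ)..T, h' t = 0 := by
    have hx0 := hx.eq 0 (left_mem_Icc.2 hT)
    have hy0 := hy.eq 0 (left_mem_Icc.2 hT)
    rw [integral_eq_of_hasDerivAt_off_countable_of_le (fun t => inner ℝ (ρ t) (y t - x t)) h' hT
      (s := range τ ∪ range τ₀) ((countable_range _).union (countable_range _))
      (hρc.inner hzc) ?_ ih']
    · simp only [hρ.terminal, inner_zero_left, hx0, hy0, intervalIntegral.integral_same, sub_self,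
        inner_zero_right]
    · rintro t ⟨ht, hts⟩
      rw [mem_union, not_or] at hts
      have dx := hx.hasDerivAt (fun a => (hf a).continuous) ht (eventually_activeMode_eq hts.2)
      have dy := hy.hasDerivAt (fun a => (hf a).continuous) ht (eventually_activeMode_eq hts.1)
      have dρ := hρ.hasDerivAt t ht hts.2
      refine (dρ.inner ℝ (dy.sub dx)).congr_deriv ?_
      rw [hh', inner_sub_left, inner_neg_left, ContinuousLinearMap.adjoint_inner_left,
        gradient, InnerProductSpace.toDual_symm_apply, inner_sub_right]
      simp only [Pi.sub_apply, c, c₀]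
      ring
  have hrem : (∫ s in (0 : ℝ)..T, ℓ (y s)) - (∫ s in (0 : ℝ)..T, ℓ (x s)) -
      (∫ s in (0 : ℝ)..T, inner ℝ (ρ s) (f (c s) (x s) - f (c₀ s) (x s))) =
      ∫ s in (0 : ℝ)..T, (ℓ (y s) - ℓ (x s) - inner ℝ (ρ s) (f (c s) (x s) - f (c₀ s) (x s)) +
        h' s) := by
    have i1 : IntervalIntegrable (fun s => inner ℝ (ρ s) (f (c s) (x s) - f (c₀ s) (x s)))
        volume 0 T := by
      simpa only [inner_sub_right] using iA'.sub iB
    rw [intervalIntegral.integral_add (((iℓ hyc).sub (iℓ hxc)).sub i1) ih', hzero, add_zero,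
      intervalIntegral.integral_sub ((iℓ hyc).sub (iℓ hxc)) i1,
      intervalIntegral.integral_sub (iℓ hyc) (iℓ hxc)]
  rw [hrem, ← Real.norm_eq_abs]
  have imis := intervalIntegrable_ite_mode hc hc₀ 0 T
  have hbound : ∀ t ∈ Ioc 0 T,
      ‖ℓ (y t) - ℓ (x t) - inner ℝ (ρ t) (f (c t) (x t) - f (c₀ t) (x t)) + h' t‖ ≤
        (Kℓ + P * Kf) * (C * ε') ^ 2 + 2 * P * L * (C * ε') * (if c t = c₀ t then 0 else 1) := by
    intro t ht
    have htI : t ∈ Icc 0 T := ⟨ht.1.le, ht.2⟩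
    have hz := hyx t htI
    set z := y t - x t
    -- The first two groups are Taylor remainders, quadratic in `z` and hence in the mismatch. The
    -- third is only linear in `z`, but it vanishes unless the modes differ, so integration supplies
    -- the second factor.
    have heq : ℓ (y t) - ℓ (x t) - inner ℝ (ρ t) (f (c t) (x t) - f (c₀ t) (x t)) + h' t =
        (ℓ (y t) - ℓ (x t) - fderiv ℝ ℓ (x t) z) +
        inner ℝ (ρ t) (f (c t) (y t) - f (c t) (x t) - fderiv ℝ (f (c t)) (x t) z) +
        inner ℝ (ρ t) (fderiv ℝ (f (c t)) (x t) z - fderiv ℝ (f (c₀ t)) (x t) z) := by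
      simp only [hh', inner_sub_right]; ring
    rw [heq]
    have b1 : ‖ℓ (y t) - ℓ (x t) - fderiv ℝ ℓ (x t) z‖ ≤ Kℓ * (C * ε') ^ 2 :=
      (norm_sub_sub_fderiv_le hℓ hKℓ _ _).trans (by gcongr)
    have b2 : ‖(inner ℝ (ρ t) (f (c t) (y t) - f (c t) (x t) - fderiv ℝ (f (c t)) (x t) z) : ℝ)‖ ≤
        P * (Kf * (C * ε') ^ 2) := by
      refine (norm_inner_le_norm _ _).trans ?_
      have := (norm_sub_sub_fderiv_le (hf (c t)) (hKf (c t)) (x t) (y t)).trans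
        (mul_le_mul_of_nonneg_left (pow_le_pow_left₀ (norm_nonneg _) hz 2) hKf0)
      exact mul_le_mul (hP t htI) this (norm_nonneg _) hP0
    have b3 : ‖(inner ℝ (ρ t) (fderiv ℝ (f (c t)) (x t) z - fderiv ℝ (f (c₀ t)) (x t) z) : ℝ)‖ ≤
        2 * P * L * (C * ε') * (if c t = c₀ t then 0 else 1) := by
      split_ifs with h
      · rw [h]; simp
      · refine (norm_inner_le_norm _ _).trans ?_
        have e1 : ∀ a, ‖fderiv ℝ (f a) (x t) z‖ ≤ L * (C * ε') := fun a =>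
          ((fderiv ℝ (f a) (x t)).le_opNorm z).trans
            (mul_le_mul (hL a t htI) hz (norm_nonneg _) hL0)
        have e2 : ‖fderiv ℝ (f (c t)) (x t) z - fderiv ℝ (f (c₀ t)) (x t) z‖ ≤
            2 * (L * (C * ε')) := by
          have := _root_.norm_sub_le (fderiv ℝ (f (c t)) (x t) z) (fderiv ℝ (f (c₀ t)) (x t) z)
          have := e1 (c t)
          have := e1 (c₀ t)
          linarith
        refine (mul_le_mul (hP t htI) e2 (norm_nonneg _) hP0).trans_eq ?_
        ring
    refine (norm_add₃_le).trans ?_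
    linarith
  refine (intervalIntegral.norm_integral_le_of_norm_le hT (ae_of_all _ hbound)
    (intervalIntegrable_const.add (imis.const_mul _))).trans_eq ?_
  rw [intervalIntegral.integral_add intervalIntegrable_const (imis.const_mul _),
    intervalIntegral.integral_const, intervalIntegral.integral_const_mul]
  change (T - 0) • _ + _ * ε' = _
  rw [smul_eq_mul]
  ring

end Cost

/-! ### Gluing a schedule from the intervals of a finite partition -/

section Construction

variable {N : ℕ}

open Classical in
/-- The indicator function of the disagreement of two controls. -/
noncomputable def disagreement (v u : ℝ → Fin N → ℝ) (t : ℝ) : ℝ := if v t = u t then 0 else 1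

/-- Up to the time `b γ`, the controls `v γ` have for `γ > γ₀` near `γ₀` mode schedules with a
common mode sequence ending in `c`.  Every switching time satisfies `G` together with its
neighbouring modes and a reference time, and the duration of the disagreement with `u` exceeds the
total distance to the reference times by `e γ`. -/
def HasSchedulePrefix (G : Fin N → Fin N → (ℝ → ℝ) → ℝ → Prop) (v : ℝ → ℝ → Fin N → ℝ)
    (u : ℝ → Fin N → ℝ) (γ₀ : ℝ) (b : ℝ → ℝ) (c : Fin N) (e : ℝ → ℝ) : Prop :=
  ∃ (m : ℕ) (σ : Fin (m + 1) → Fin N) (τ : ℝ → Fin m → ℝ) (L : Fin m → ℝ),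
    σ (Fin.last m) = c ∧ (∀ i, G (σ i.castSucc) (σ i.succ) (fun γ => τ γ i) (L i)) ∧
    ∀ᶠ γ in 𝓝[>] γ₀, 0 ≤ b γ ∧ IsModeSchedule (b γ) σ (τ γ) ∧
      (∀ᵐ t, t ∈ Ioc 0 (b γ) → v γ t = scheduleControl σ (τ γ) t) ∧
      IntervalIntegrable (disagreement (v γ) u) volume 0 (b γ) ∧
      ∫ t in (0 : ℝ)..b γ, disagreement (v γ) u t = (∑ i, |τ γ i - L i|) + e γ

variable {G : Fin N → Fin N → (ℝ → ℝ) → ℝ → Prop} {v : ℝ → ℝ → Fin N → ℝ}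
  {u : ℝ → Fin N → ℝ} {γ₀ : ℝ} {b b' : ℝ → ℝ} {c c' : Fin N} {e e' : ℝ → ℝ}

theorem hasSchedulePrefix_zero (c : Fin N) : HasSchedulePrefix G v u γ₀ (fun _ => 0) c fun _ => 0 := by
  refine ⟨0, fun _ => c, fun _ i => i.elim0, fun i => i.elim0, rfl, fun i => i.elim0,
    Eventually.of_forall fun γ => ⟨le_rfl, ⟨fun i => i.elim0, fun i => i.elim0, fun i => i.elim0⟩,
      by simp, by simp, by simp⟩⟩

theorem ae_of_forall_Ioo {p q : ℝ} {P : ℝ → Prop} (h : ∀ t ∈ Ioo p q, P t) :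
    ∀ᵐ t, t ∈ Ioc p q → P t := by
  have : ∀ᵐ t : ℝ, t ≠ q := by simp [ae_iff]
  filter_upwards [this] with t ht htI
  exact h t ⟨htI.1, lt_of_le_of_ne htI.2 ht⟩

theorem HasSchedulePrefix.extend (h : HasSchedulePrefix G v u γ₀ b c e) {κ : ℝ}
    (hb : ∀ᶠ γ in 𝓝[>] γ₀, b γ < b' γ) (hpos : c' ≠ c → ∀ᶠ γ in 𝓝[>] γ₀, 0 < b γ)
    (hv : ∀ᶠ γ in 𝓝[>] γ₀, ∀ t ∈ Ioo (b γ) (b' γ), v γ t = Pi.single c' 1)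
    (hκ : ∀ᶠ γ in 𝓝[>] γ₀, ∀ t ∈ Ioo (b γ) (b' γ), disagreement (v γ) u t = κ)
    {L : ℝ} (hG : c' ≠ c → G c c' b L)
    (he : ∀ᶠ γ in 𝓝[>] γ₀,
      e' γ = e γ + κ * (b' γ - b γ) - if c' = c then 0 else |b γ - L|) :
    HasSchedulePrefix G v u γ₀ b' c' e' := by
  obtain ⟨m, σ, τ, Λ, hlast, hGi, hev⟩ := h
  have hint : ∀ᶠ γ in 𝓝[>] γ₀, IntervalIntegrable (disagreement (v γ) u) volume 0 (b' γ) ∧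
      ∫ t in (0 : ℝ)..b' γ, disagreement (v γ) u t =
        (∑ i, |τ γ i - Λ i|) + e γ + κ * (b' γ - b γ) := by
    filter_upwards [hev, hb, hκ] with γ ⟨_, _, _, h1, h2⟩ hlt h3
    have hae : ∀ᵐ t, t ∈ uIoc (b γ) (b' γ) → κ = disagreement (v γ) u t := by
      rw [uIoc_of_le hlt.le]
      exact ae_of_forall_Ioo fun t ht => (h3 t ht).symm
    have h4 : IntervalIntegrable (disagreement (v γ) u) volume (b γ) (b' γ) :=
      (intervalIntegrable_const (c := κ)).congr_ae ((ae_restrict_iff' measurableSet_uIoc).2 hae)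
    refine ⟨h1.trans h4, ?_⟩
    rw [← intervalIntegral.integral_add_adjacent_intervals h1 h4, h2,
      ← intervalIntegral.integral_congr_ae hae, intervalIntegral.integral_const, smul_eq_mul]
    ring
  by_cases hc : c' = c
  · subst hc
    refine ⟨m, σ, τ, Λ, hlast, hGi, ?_⟩
    filter_upwards [hev, hb, hv, hint, he] with γ ⟨h0, h1, h2, _, _⟩ hlt h3 ⟨h4, h5⟩ h6
    refine ⟨h0.trans hlt.le, ⟨h1.strictMono, fun i => ⟨(h1.mem_Ioo i).1,
      (h1.mem_Ioo i).2.trans hlt⟩, h1.mode_ne⟩, ?_, h4, ?_⟩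
    · filter_upwards [h2, ae_of_forall_Ioo h3] with t h7 h8 htI
      rcases le_or_gt t (b γ) with h | h
      · exact h7 ⟨htI.1, h⟩
      · rw [h8 ⟨h, htI.2⟩, scheduleControl,
          activeMode_of_forall_le fun i => (h1.mem_Ioo i).2.le.trans h.le, hlast]
    · rw [h5, h6, if_pos rfl]; ring
  · refine ⟨m + 1, Fin.snoc σ c', fun γ => Fin.snoc (τ γ) (b γ), Fin.snoc Λ L, by simp,
      fun i => ?_, ?_⟩
    · refine Fin.lastCases ?_ (fun i => ?_) i
      · simpa only [Fin.snoc_castSucc, Fin.snoc_last, Fin.succ_last, hlast] using hG hc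
      · simpa only [Fin.snoc_castSucc, Fin.succ_castSucc] using hGi i
    filter_upwards [hev, hb, hv, hint, he, hpos hc] with γ ⟨h0, h1, h2, _, _⟩ hlt h3 ⟨h4, h5⟩ h6 hp
    refine ⟨h0.trans hlt.le, ⟨?_, fun i => ?_, fun i => ?_⟩, ?_, h4, ?_⟩
    · intro i j hij
      induction i using Fin.lastCases with
      | last => exact absurd hij (Fin.le_last j).not_gt
      | cast i =>
        induction j using Fin.lastCases with
        | last => simpa using (h1.mem_Ioo i).2
        | cast j => simpa using h1.strictMono (Fin.castSucc_lt_castSucc_iff.1 hij)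
    · refine Fin.lastCases ?_ (fun i => ?_) i
      · simpa using ⟨hp, hlt⟩
      · simpa using ⟨(h1.mem_Ioo i).1, (h1.mem_Ioo i).2.trans hlt⟩
    · refine Fin.lastCases ?_ (fun i => ?_) i
      · simpa only [Fin.snoc_castSucc, Fin.snoc_last, Fin.succ_last, hlast] using Ne.symm hc
      · simpa only [Fin.snoc_castSucc, Fin.succ_castSucc] using h1.mode_ne i
    · have hbne : ∀ᵐ t : ℝ, t ≠ b γ := by simp [ae_iff]
      filter_upwards [h2, ae_of_forall_Ioo h3, hbne] with t h7 h8 hne htI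
      rcases lt_or_gt_of_ne hne with h | h
      · rw [h7 ⟨htI.1, h.le⟩, scheduleControl, scheduleControl, activeMode_snoc h]
      · rw [h8 ⟨h, htI.2⟩, scheduleControl, activeMode_of_forall_le, Fin.snoc_last]
        intro i
        refine Fin.lastCases ?_ (fun i => ?_) i
        · simpa using h.le
        · simpa using ((h1.mem_Ioo i).2.trans h).le
    · rw [h5, h6, if_neg hc, Fin.sum_univ_castSucc]
      simp only [Fin.snoc_castSucc, Fin.snoc_last]
      ring

/-- The possible shapes of the controls `v γ` on an interval `(p, q)` on which `u` has a single
mode: either no other mode is inserted, or one is inserted at the beginning, or at the end. -/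
def InsertsAtMostOnce (G : Fin N → Fin N → (ℝ → ℝ) → ℝ → Prop) (v : ℝ → ℝ → Fin N → ℝ)
    (u : ℝ → Fin N → ℝ) (γ₀ p q : ℝ) : Prop :=
  ∃ s : Fin N, (∀ t ∈ Ioo p q, u t = Pi.single s 1) ∧
    ((∀ᶠ γ in 𝓝[>] γ₀, ∀ t ∈ Ioo p q, v γ t = Pi.single s 1) ∨
      ∃ (a : Fin N) (r : ℝ → ℝ), a ≠ s ∧ (∀ᶠ γ in 𝓝[>] γ₀, r γ ∈ Ioo p q) ∧
        ((G a s r p ∧ (∀ᶠ γ in 𝓝[>] γ₀, ∀ t ∈ Ioo p (r γ), v γ t = Pi.single a 1) ∧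
            ∀ᶠ γ in 𝓝[>] γ₀, ∀ t ∈ Ioo (r γ) q, v γ t = Pi.single s 1) ∨
          (G s a r q ∧ (∀ᶠ γ in 𝓝[>] γ₀, ∀ t ∈ Ioo p (r γ), v γ t = Pi.single s 1) ∧
            ∀ᶠ γ in 𝓝[>] γ₀, ∀ t ∈ Ioo (r γ) q, v γ t = Pi.single a 1)))

theorem disagreement_eq_zero {v u : ℝ → Fin N → ℝ} {t : ℝ} {s : Fin N}
    (hv : v t = Pi.single s 1) (hu : u t = Pi.single s 1) : disagreement v u t = 0 :=
  if_pos (hv.trans hu.symm)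

theorem disagreement_eq_one {v u : ℝ → Fin N → ℝ} {t : ℝ} {a s : Fin N} (has : a ≠ s)
    (hv : v t = Pi.single a 1) (hu : u t = Pi.single s 1) : disagreement v u t = 1 :=
  if_neg fun h => has (single_one_inj.1 (hv.symm.trans (h.trans hu)))

/-- Across the whole interval the excess returns to zero: the inserted mode disagrees with `u`
exactly between the new switching time and the end point that serves as its reference time. A switch
at `p` itself is constant and contributes no displacement. -/
theorem HasSchedulePrefix.extend_gap (hGc : ∀ α β L, G α β (fun _ => L) L) {p q : ℝ}
    (hp : HasSchedulePrefix G v u γ₀ (fun _ => p) c fun _ => 0) (hp0 : 0 ≤ p) (hpq : p < q)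
    (h : InsertsAtMostOnce G v u γ₀ p q) :
    ∃ c', HasSchedulePrefix G v u γ₀ (fun _ => q) c' fun _ => 0 := by
  obtain ⟨s, hu, h⟩ := h
  -- A switching time must be positive. For p = 0 the schedule is still empty, and its only mode can
  -- be chosen equal to the next one, so that no switch takes place.
  have start : ∀ a : Fin N, ∃ c, HasSchedulePrefix G v u γ₀ (fun _ => p) c (fun _ => 0) ∧
      (a ≠ c → 0 < p) := fun a => by
    rcases hp0.eq_or_lt with h0 | h0
    · exact ⟨a, by rw [← h0]; exact hasSchedulePrefix_zero a, fun h => absurd rfl h⟩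
    · exact ⟨c, hp, fun _ => h0⟩
  rcases h with h | ⟨a, r, has, hr, ⟨hG, h1, h2⟩ | ⟨hG, h1, h2⟩⟩
  · obtain ⟨c, hc, hcp⟩ := start s
    refine ⟨s, hc.extend (κ := 0) (L := p) (Eventually.of_forall fun _ => hpq)
      (fun hne => Eventually.of_forall fun _ => hcp hne) h ?_ (fun _ => hGc _ _ _) ?_⟩
    · filter_upwards [h] with γ hγ t ht using disagreement_eq_zero (hγ t ht) (hu t ht)
    · simp
  · obtain ⟨c, hc, hcp⟩ := start a
    -- Insertion at the left end: the disagreement on (p, r) is recorded as excess and is paid off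
    -- by the switch at `r` with reference time `p`.
    have step : HasSchedulePrefix G v u γ₀ r a fun γ => r γ - p := by
      refine hc.extend (κ := 1) (L := p) (hr.mono fun _ h => h.1)
        (fun hne => Eventually.of_forall fun _ => hcp hne) h1 ?_ (fun _ => hGc _ _ _) ?_
      · filter_upwards [h1, hr] with γ hγ hrγ t ht using
          disagreement_eq_one has (hγ t ht) (hu t ⟨ht.1, ht.2.trans hrγ.2⟩)
      · simp
    refine ⟨s, step.extend (κ := 0) (L := p) (hr.mono fun _ h => h.2)
      (fun _ => hr.mono fun _ h => hp0.trans_lt h.1) h2 ?_ (fun _ => hG) ?_⟩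
    · filter_upwards [h2, hr] with γ hγ hrγ t ht using
        disagreement_eq_zero (hγ t ht) (hu t ⟨hrγ.1.trans ht.1, ht.2⟩)
    · filter_upwards [hr] with γ hrγ
      rw [if_neg has.symm, abs_of_pos (sub_pos.2 hrγ.1)]; ring
  · obtain ⟨c, hc, hcp⟩ := start s
    -- Insertion at the right end: the switch at `r` is charged |r - q| in advance, and the
    -- disagreement on (r, q) makes up for it.
    have step : HasSchedulePrefix G v u γ₀ r s fun _ => 0 := by
      refine hc.extend (κ := 0) (L := p) (hr.mono fun _ h => h.1)
        (fun hne => Eventually.of_forall fun _ => hcp hne) h1 ?_ (fun _ => hGc _ _ _) ?_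
      · filter_upwards [h1, hr] with γ hγ hrγ t ht using
          disagreement_eq_zero (hγ t ht) (hu t ⟨ht.1, ht.2.trans hrγ.2⟩)
      · simp
    refine ⟨a, step.extend (κ := 1) (L := q) (hr.mono fun _ h => h.2)
      (fun _ => hr.mono fun _ h => hp0.trans_lt h.1) h2 ?_ (fun _ => hG) ?_⟩
    · filter_upwards [h2, hr] with γ hγ hrγ t ht using
        disagreement_eq_one has (hγ t ht) (hu t ⟨hrγ.1.trans ht.1, ht.2⟩)
    · filter_upwards [hr] with γ hrγ
      rw [if_neg has, abs_of_neg (sub_neg.2 hrγ.2)]; ring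

/-- A schedule on `[0, T]` exists if there is a finite partition on whose intervals at most one
mode is inserted at one of the ends. -/
theorem exists_hasSchedulePrefix [Nonempty (Fin N)] (hGc : ∀ α β L, G α β (fun _ => L) L)
    {B : Set ℝ} (hB : B.Finite) (h0 : 0 ∈ B) (hB0 : ∀ z ∈ B, 0 ≤ z)
    (hgap : ∀ p ∈ B, ∀ q ∈ B, p < q → (∀ z ∈ B, z ≤ p ∨ q ≤ z) → InsertsAtMostOnce G v u γ₀ p q) :
    ∀ q ∈ B, ∃ c, HasSchedulePrefix G v u γ₀ (fun _ => q) c fun _ => 0 := by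
  have wf := hB.wellFoundedOn (r := (· < ·))
  intro q hq
  refine wf.induction (P := fun q => ∃ c, HasSchedulePrefix G v u γ₀ (fun _ => q) c fun _ => 0)
    hq fun q hq ih => ?_
  rcases (hB0 q hq).eq_or_lt with h | h
  · obtain ⟨c⟩ := ‹Nonempty (Fin N)›
    exact ⟨c, by rw [← h]; exact hasSchedulePrefix_zero c⟩
  obtain ⟨p, hp⟩ := ((hB.subset (sep_subset B (· < q))).isCompact).exists_isGreatest ⟨0, h0, h⟩
  have hpB : p ∈ B := hp.1.1
  have hpq : p < q := hp.1.2
  obtain ⟨c, hc⟩ := ih p hpB hpq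
  exact hc.extend_gap hGc (hB0 p hpB) hpq
    (hgap p hpB q hq hpq fun z hz => (lt_or_ge z q).imp (fun h => hp.2 ⟨hz, h⟩) id)

end Construction

/-! ### Asymptotics of moving switching times -/

section Asymptotics

/-- Because θ = -1/γ₀, the quotient equals 1/(γγ₀), which tends to 1/γ₀² = θ². -/
theorem tendsto_neg_inv_sub_div {θ γ₀ : ℝ} (hθ : θ < 0) (hγ₀ : γ₀ = -1 / θ) :
    Tendsto (fun γ => (-1 / γ - θ) / (γ - γ₀)) (𝓝[>] γ₀) (𝓝 (θ ^ 2)) := by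
  have hpos : 0 < γ₀ := by rw [hγ₀]; exact div_pos_of_neg_of_neg (by norm_num) hθ
  have hθγ : θ = -1 / γ₀ := by rw [hγ₀]; field_simp
  have h1 : Tendsto (fun γ => 1 / (γ * γ₀)) (𝓝[>] γ₀) (𝓝 (1 / (γ₀ * γ₀))) := by
    refine Tendsto.mono_left ?_ nhdsWithin_le_nhds
    exact (ContinuousAt.div continuousAt_const (by fun_prop) (by positivity)).tendsto
  have h2 : θ ^ 2 = 1 / (γ₀ * γ₀) := by rw [hθγ]; field_simp
  rw [h2]
  refine h1.congr' ?_
  filter_upwards [self_mem_nhdsWithin] with γ hγ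
  have hγ : γ₀ < γ := hγ
  have : γ - γ₀ ≠ 0 := (sub_pos.2 hγ).ne'
  have : γ ≠ 0 := (hpos.trans hγ).ne'
  rw [hθγ]
  field_simp
  ring

/-- Asymptotics of the solution `h γ` of `g (h γ) = -1 / γ` near a point where `g = θ`. -/
theorem asymptotics_of_level {θ γ₀ η A₁ A₂ : ℝ} (hθ : θ < 0) (hγ₀ : γ₀ = -1 / θ) (hη : 0 < η)
    {g g₁ g₂ h : ℝ → ℝ} (hg : ∀ t ∈ Ioo 0 η, HasDerivAt g (g₁ t) t)
    (hg₁ : ∀ t ∈ Ioo 0 η, HasDerivAt g₁ (g₂ t) t) (l : Tendsto g (𝓝[>] 0) (𝓝 θ))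
    (l₁ : Tendsto g₁ (𝓝[>] 0) (𝓝 A₁)) (l₂ : Tendsto g₂ (𝓝[>] 0) (𝓝 A₂))
    (hh : Tendsto h (𝓝[>] γ₀) (𝓝[>] 0)) (hgh : ∀ᶠ γ in 𝓝[>] γ₀, g (h γ) = -1 / γ) :
    0 ≤ A₁ ∧ (A₁ ≠ 0 → Tendsto (fun γ => h γ / (γ - γ₀)) (𝓝[>] γ₀) (𝓝 (θ ^ 2 / A₁))) ∧
      (A₁ = 0 → A₂ ≠ 0 → 0 < A₂ ∧
        Tendsto (fun γ => h γ / √(γ - γ₀)) (𝓝[>] γ₀) (𝓝 (√2 * |θ| / √A₂))) := by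
  have hmem : ∀ᶠ t in 𝓝[>] (0 : ℝ), t ∈ Ioo 0 η := Ioo_mem_nhdsGT hη
  have hd : ∀ᶠ t in 𝓝[>] (0 : ℝ), HasDerivAt (fun t => g t - θ) (g₁ t) t :=
    hmem.mono fun t ht => (hg t ht).sub_const θ
  have hl : Tendsto (fun t => g t - θ) (𝓝[>] 0) (𝓝 0) := by simpa using l.sub_const θ
  have hid : Tendsto (fun t : ℝ => t) (𝓝[>] 0) (𝓝 0) := tendsto_id.mono_left nhdsWithin_le_nhds
  have hk := tendsto_neg_inv_sub_div hθ hγ₀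
  have hhpos : ∀ᶠ γ in 𝓝[>] γ₀, 0 < h γ := hh.eventually self_mem_nhdsWithin
  have hγpos : ∀ᶠ γ in 𝓝[>] γ₀, 0 < γ - γ₀ := by
    filter_upwards [self_mem_nhdsWithin] with γ hγ using sub_pos.2 hγ
  have hkpos : ∀ᶠ γ in 𝓝[>] γ₀, 0 < -1 / γ - θ := by
    have hθ2 : 0 < θ ^ 2 := sq_pos_of_neg hθ
    filter_upwards [hk.eventually (lt_mem_nhds hθ2), hγpos] with γ h1 h2
    exact (div_pos_iff_of_pos_right h2).1 h1
  -- L'Hôpital's rule needs only one-sided information. Substituting t = h γ turns g - θ into -1/γ -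
  -- θ, whose rate in γ - γ₀ is known; dividing the two limits gives the rate of `h`. When `A₁`
  -- vanishes, the same is done with t² in place of t.
  have quot1 : Tendsto (fun t => (g t - θ) / t) (𝓝[>] 0) (𝓝 A₁) :=
    HasDerivAt.lhopital_zero_nhdsGT (f' := g₁) (g' := fun _ => 1) hd
      (Eventually.of_forall fun t => hasDerivAt_id t) (by simp) hl hid (by simpa using l₁)
  have k1 : Tendsto (fun γ => (-1 / γ - θ) / h γ) (𝓝[>] γ₀) (𝓝 A₁) :=
    (quot1.comp hh).congr' (by filter_upwards [hgh] with γ h1; simp [h1])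
  have hA₁ : 0 ≤ A₁ := ge_of_tendsto k1 (by
    filter_upwards [hkpos, hhpos] with γ h1 h2 using (div_pos h1 h2).le)
  refine ⟨hA₁, fun hne => ?_, fun h0 hne => ?_⟩
  · refine (hk.div k1 hne).congr' ?_
    filter_upwards [hkpos, hhpos, hγpos] with γ h1 h2 h3
    simp only [Pi.div_apply]
    generalize -1 / γ - θ = k at h1 ⊢
    field_simp
  · subst h0
    have quot2 : Tendsto (fun t => (g t - θ) / t ^ 2) (𝓝[>] 0) (𝓝 (A₂ / 2)) := by
      have q1 : Tendsto (fun t => g₁ t / (2 * t)) (𝓝[>] 0) (𝓝 (A₂ / 2)) :=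
        HasDerivAt.lhopital_zero_nhdsGT (f' := g₂) (g' := fun _ => 2)
          (hmem.mono fun t ht => hg₁ t ht)
          (Eventually.of_forall fun t => by simpa using (hasDerivAt_id t).const_mul 2) (by simp) l₁
          (by simpa using hid.const_mul 2) (l₂.div_const 2)
      refine HasDerivAt.lhopital_zero_nhdsGT (f' := g₁) (g' := fun t => 2 * t) hd
        (Eventually.of_forall fun t => by simpa using hasDerivAt_pow 2 t) ?_ hl
        (by simpa using hid.pow 2) q1
      filter_upwards [self_mem_nhdsWithin] with t ht
      exact mul_ne_zero two_ne_zero (ne_of_gt ht)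
    have k2 : Tendsto (fun γ => (-1 / γ - θ) / h γ ^ 2) (𝓝[>] γ₀) (𝓝 (A₂ / 2)) :=
      (quot2.comp hh).congr' (by filter_upwards [hgh] with γ h1; simp [h1])
    have hA₂ : 0 < A₂ := by
      have : 0 ≤ A₂ / 2 := ge_of_tendsto k2 (by
        filter_upwards [hkpos, hhpos] with γ h1 h2 using (div_pos h1 (by positivity)).le)
      exact lt_of_le_of_ne (by linarith) hne.symm
    refine ⟨hA₂, ?_⟩
    have k3 : Tendsto (fun γ => h γ ^ 2 / (γ - γ₀)) (𝓝[>] γ₀) (𝓝 (θ ^ 2 / (A₂ / 2))) := by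
      refine (hk.div k2 (by positivity)).congr' ?_
      filter_upwards [hkpos, hhpos, hγpos] with γ h1 h2 h3
      simp only [Pi.div_apply]
      generalize -1 / γ - θ = k at h1 ⊢
      field_simp
    have k4 := k3.sqrt
    have h5 : √(θ ^ 2 / (A₂ / 2)) = √2 * |θ| / √A₂ := by
      rw [show θ ^ 2 / (A₂ / 2) = 2 * θ ^ 2 / A₂ by field_simp, Real.sqrt_div (by positivity),
        Real.sqrt_mul (by norm_num), Real.sqrt_sq_eq_abs]
    rw [h5] at k4
    refine k4.congr' ?_
    filter_upwards [hhpos] with γ h2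
    rw [Real.sqrt_div (by positivity), Real.sqrt_sq h2.le]

/-- A switching time `r γ` between the modes `α` and `β` that moves away from `L` as `γ` increases
from `γ₀`, to the right if `ς = 1` and to the left if `ς = -1`.  The mode `a` is the inserted one,
and `D₁`, `D₂` are the one-sided derivatives of its insertion gradient at `L`. -/
structure MovingSwitch {N : ℕ} (d : ℝ → Fin N → ℝ) (θ γ₀ : ℝ) (α β : Fin N) (r : ℝ → ℝ) (L : ℝ)
    (a : Fin N) (ς D₁ D₂ : ℝ) : Prop where
  mode : ς = 1 ∧ a = α ∨ ς = -1 ∧ a = β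
  tendsto : Tendsto r (𝓝[>] γ₀) (𝓝 L)
  pos : ∀ᶠ γ in 𝓝[>] γ₀, 0 < ς * (r γ - L)
  deriv_sub : Tendsto (fun γ => deriv (fun s => d s α - d s β) (r γ)) (𝓝[>] γ₀) (𝓝 (ς * D₁))
  deriv_two_sub : Tendsto (fun γ => iteratedDeriv 2 (fun s => d s α - d s β) (r γ)) (𝓝[>] γ₀)
    (𝓝 (ς * D₂))
  deriv_mode : Tendsto (fun γ => deriv (fun s => d s a) (r γ)) (𝓝[>] γ₀) (𝓝 D₁)
  deriv_two_mode : Tendsto (fun γ => iteratedDeriv 2 (fun s => d s a) (r γ)) (𝓝[>] γ₀) (𝓝 D₂)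
  asymptotics_one : D₁ ≠ 0 →
    Tendsto (fun γ => ς * (r γ - L) / (γ - γ₀)) (𝓝[>] γ₀) (𝓝 (θ ^ 2 / (ς * D₁)))
  nonneg : 0 ≤ ς * D₁
  asymptotics_two : D₁ = 0 → D₂ ≠ 0 → 0 < D₂ ∧
    Tendsto (fun γ => ς * (r γ - L) / √(γ - γ₀)) (𝓝[>] γ₀) (𝓝 (√2 * |θ| / √D₂))

/-- On `(p, q)`, `F₁` and `F₂` are the first two derivatives of `F`, and all three functions are
continuous up to the end points. -/
structure HasTwoDerivs (p q : ℝ) (F F₁ F₂ : ℝ → ℝ) : Prop where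
  cont : ContinuousOn F (Icc p q)
  cont_one : ContinuousOn F₁ (Icc p q)
  cont_two : ContinuousOn F₂ (Icc p q)
  hasDerivAt : ∀ t ∈ Ioo p q, HasDerivAt F (F₁ t) t
  hasDerivAt_one : ∀ t ∈ Ioo p q, HasDerivAt F₁ (F₂ t) t

theorem HasTwoDerivs.deriv_eq {p q t : ℝ} {F F₁ F₂ : ℝ → ℝ} (h : HasTwoDerivs p q F F₁ F₂)
    (ht : t ∈ Ioo p q) {k : ℝ → ℝ} {z : ℝ} (hk : ∀ s ∈ Ioo p q, k s = z * F s) :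
    deriv k t = z * F₁ t ∧ iteratedDeriv 2 k t = z * F₂ t := by
  have h1 : ∀ s ∈ Ioo p q, deriv k s = z * F₁ s := fun s hs => by
    refine (((h.hasDerivAt s hs).const_mul z).congr_of_eventuallyEq ?_).deriv
    filter_upwards [Ioo_mem_nhds hs.1 hs.2] with w hw using hk w hw
  refine ⟨h1 t ht, ?_⟩
  rw [iteratedDeriv_succ, iteratedDeriv_one]
  refine (((h.hasDerivAt_one t ht).const_mul z).congr_of_eventuallyEq ?_).deriv
  filter_upwards [Ioo_mem_nhds ht.1 ht.2] with w hw using h1 w hw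

/-- The substitution t ↦ L + ςt maps a right neighbourhood of 0 into the interval from either end,
so one asymptotic result covers both. Under it the first derivative acquires the factor ς and the
second acquires ς² = 1. The same sign relates d_α - d_β to `F`, since the inserted mode precedes the
switch at the left end and follows it at the right end. -/
theorem HasTwoDerivs.movingSwitch {N : ℕ} {d : ℝ → Fin N → ℝ} {θ γ₀ p q L ς : ℝ} {F F₁ F₂ : ℝ → ℝ}
    (h : HasTwoDerivs p q F F₁ F₂) (hpq : p < q) (hθ : θ < 0) (hγ₀ : γ₀ = -1 / θ)
    {a α β : Fin N} {r : ℝ → ℝ} (hς : ς = 1 ∧ a = α ∧ L = p ∨ ς = -1 ∧ a = β ∧ L = q)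
    (hF : F L = θ) (hFd : ∀ s ∈ Ioo p q, d s a = F s)
    (hFsub : ∀ s ∈ Ioo p q, d s α - d s β = ς * F s) (hr : ∀ᶠ γ in 𝓝[>] γ₀, r γ ∈ Ioo p q)
    (hrL : Tendsto r (𝓝[>] γ₀) (𝓝 L)) (hrF : ∀ᶠ γ in 𝓝[>] γ₀, F (r γ) = -1 / γ) :
    MovingSwitch d θ γ₀ α β r L a ς (F₁ L) (F₂ L) := by
  have hς2 : ς * ς = 1 := by rcases hς with ⟨h, _⟩ | ⟨h, _⟩ <;> rw [h] <;> norm_num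
  have hLmem : L ∈ Icc p q := by
    rcases hς with ⟨_, _, h⟩ | ⟨_, _, h⟩ <;> rw [h]
    exacts [left_mem_Icc.2 hpq.le, right_mem_Icc.2 hpq.le]
  have hmap : ∀ t ∈ Ioo 0 (q - p), L + ς * t ∈ Ioo p q := by
    intro t ht
    rcases hς with ⟨h, _, h'⟩ | ⟨h, _, h'⟩ <;> rw [h, h'] <;> constructor <;>
      linarith [ht.1, ht.2]
  have hpos : ∀ s ∈ Ioo p q, 0 < ς * (s - L) := by
    intro s hs
    rcases hς with ⟨h, _, h'⟩ | ⟨h, _, h'⟩ <;> rw [h, h'] <;> linarith [hs.1, hs.2]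
  have hlim : Tendsto (fun t => L + ς * t) (𝓝[>] 0) (𝓝[Icc p q] L) := by
    refine tendsto_nhdsWithin_iff.2 ⟨?_, ?_⟩
    · have : Tendsto (fun t => L + ς * t) (𝓝 0) (𝓝 (L + ς * 0)) := by
        exact (by fun_prop : Continuous fun t => L + ς * t).tendsto 0
      rw [mul_zero, add_zero] at this
      exact this.mono_left nhdsWithin_le_nhds
    · filter_upwards [Ioo_mem_nhdsGT (sub_pos.2 hpq)] with t ht using Ioo_subset_Icc_self (hmap t ht)
  have hrlim : Tendsto r (𝓝[>] γ₀) (𝓝[Icc p q] L) :=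
    tendsto_nhdsWithin_iff.2 ⟨hrL, hr.mono fun γ h => Ioo_subset_Icc_self h⟩
  have r1 : Tendsto (fun γ => F₁ (r γ)) (𝓝[>] γ₀) (𝓝 (F₁ L)) := (h.cont_one L hLmem).tendsto.comp hrlim
  have r2 : Tendsto (fun γ => F₂ (r γ)) (𝓝[>] γ₀) (𝓝 (F₂ L)) := (h.cont_two L hLmem).tendsto.comp hrlim
  have hlin : ∀ t, HasDerivAt (fun t => L + ς * t) ς t := fun t => by
    simpa using ((hasDerivAt_id t).const_mul ς).const_add L
  obtain ⟨c1, c2, c3⟩ := asymptotics_of_level (g := fun t => F (L + ς * t))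
    (g₁ := fun t => ς * F₁ (L + ς * t)) (g₂ := fun t => F₂ (L + ς * t))
    (h := fun γ => ς * (r γ - L)) (A₁ := ς * F₁ L) (A₂ := F₂ L) hθ hγ₀ (sub_pos.2 hpq)
    (fun t ht => ((h.hasDerivAt _ (hmap t ht)).comp t (hlin t)).congr_deriv (by ring))
    (fun t ht => (((h.hasDerivAt_one _ (hmap t ht)).comp t (hlin t)).const_mul ς).congr_deriv
      (by rw [mul_left_comm, hς2, mul_one]))
    (by rw [← hF]; exact (h.cont L hLmem).tendsto.comp hlim)
    (((h.cont_one L hLmem).tendsto.comp hlim).const_mul ς)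
    ((h.cont_two L hLmem).tendsto.comp hlim)
    (tendsto_nhdsWithin_iff.2 ⟨by simpa using (hrL.sub_const L).const_mul ς,
      hr.mono fun γ h => hpos _ h⟩)
    (by
      filter_upwards [hrF] with γ hγ
      rw [← mul_assoc, hς2, one_mul, add_sub_cancel, hγ])
  have hς0 : ς ≠ 0 := fun h => by rw [h] at hς2; norm_num at hς2
  exact
    { mode := hς.imp (fun h => ⟨h.1, h.2.1⟩) (fun h => ⟨h.1, h.2.1⟩)
      tendsto := hrL
      pos := hr.mono fun γ h => hpos _ h
      deriv_sub := (r1.const_mul ς).congr' (by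
        filter_upwards [hr] with γ hγ using (h.deriv_eq hγ hFsub).1.symm)
      deriv_two_sub := (r2.const_mul ς).congr' (by
        filter_upwards [hr] with γ hγ using (h.deriv_eq hγ hFsub).2.symm)
      deriv_mode := r1.congr' (by
        filter_upwards [hr] with γ hγ
        rw [(h.deriv_eq hγ (z := 1) (by simpa using hFd)).1, one_mul])
      deriv_two_mode := r2.congr' (by
        filter_upwards [hr] with γ hγ
        rw [(h.deriv_eq hγ (z := 1) (by simpa using hFd)).2, one_mul])
      asymptotics_one := fun hne => c2 (mul_ne_zero hς0 hne)
      nonneg := c1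
      asymptotics_two := fun h0 hne => c3 (by rw [h0, mul_zero]) hne }

end Asymptotics

/-! ### Regularity and finiteness properties of the insertion gradients -/

section Regularity

/-- Along a solution of ξ' = X(ξ) the derivative of Φ(ξ) is again a function of ξ, namely e ↦
DΦ(e)X(e), which is C¹. The chain rule thus applies twice, and the resulting expressions are
continuous up to the end points, where ξ itself need not be differentiable. -/
theorem exists_hasTwoDerivs_comp {E : Type*} [NormedAddCommGroup E] [NormedSpace ℝ E] {Φ : E → ℝ}
    (hΦ : ContDiff ℝ 2 Φ) {X : E → E} (hX : ContDiff ℝ 1 X) {p q : ℝ} {ξ : ℝ → E}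
    (hc : ContinuousOn ξ (Icc p q)) (hd : ∀ t ∈ Ioo p q, HasDerivAt ξ (X (ξ t)) t) :
    ∃ F₁ F₂, HasTwoDerivs p q (fun t => Φ (ξ t)) F₁ F₂ := by
  have hΦ₁ : ContDiff ℝ 1 fun e => fderiv ℝ Φ e (X e) :=
    (hΦ.fderiv_right (by norm_num)).clm_apply hX
  refine ⟨fun t => fderiv ℝ Φ (ξ t) (X (ξ t)),
    fun t => fderiv ℝ (fun e => fderiv ℝ Φ e (X e)) (ξ t) (X (ξ t)),
    hΦ.continuous.comp_continuousOn hc, hΦ₁.continuous.comp_continuousOn hc,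
    ((hΦ₁.continuous_fderiv one_ne_zero).clm_apply hX.continuous).comp_continuousOn hc,
    fun t ht => ?_, fun t ht => ?_⟩
  · exact ((hΦ.differentiable two_ne_zero) (ξ t)).hasFDerivAt.comp_hasDerivAt t (hd t ht)
  · exact ((hΦ₁.differentiable one_ne_zero) (ξ t)).hasFDerivAt.comp_hasDerivAt t (hd t ht)

theorem contDiff_adjoint_system {n : ℕ} {g : State n → State n} {ℓ : State n → ℝ}
    (hg : ContDiff ℝ 2 g) (hℓ : ContDiff ℝ 2 ℓ) :
    ContDiff ℝ 1 fun e : State n × State n =>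
      (g e.1, -(ContinuousLinearMap.adjoint (fderiv ℝ g e.1) e.2) - gradient ℓ e.1) := by
  have h1 : ContDiff ℝ 1 fun e : State n × State n => fderiv ℝ g e.1 :=
    (hg.fderiv_right (by norm_num)).comp contDiff_fst
  have h2 : ContDiff ℝ 1 fun e : State n × State n => fderiv ℝ ℓ e.1 :=
    (hℓ.fderiv_right (by norm_num)).comp contDiff_fst
  refine ((hg.of_le (by norm_num)).comp contDiff_fst).prodMk (ContDiff.sub (ContDiff.neg ?_) ?_)
  · refine (contDiff_euclidean).2 fun i => ?_
    have : ∀ e : State n × State n, (ContinuousLinearMap.adjoint (fderiv ℝ g e.1) e.2) i =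
        inner ℝ (fderiv ℝ g e.1 (EuclideanSpace.single i 1)) e.2 := fun e => by
      rw [← ContinuousLinearMap.adjoint_inner_right, EuclideanSpace.inner_single_left]
      simp
    simp only [this]
    exact (h1.clm_apply contDiff_const).inner ℝ contDiff_snd
  · refine (contDiff_euclidean).2 fun i => ?_
    have : ∀ e : State n × State n, (gradient ℓ e.1) i =
        fderiv ℝ ℓ e.1 (EuclideanSpace.single i 1) := fun e => by
      rw [← InnerProductSpace.toDual_symm_apply (𝕜 := ℝ), real_inner_comm,
        EuclideanSpace.inner_single_left]
      simp [gradient]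
    simp only [this]
    exact h2.clm_apply contDiff_const

/-- By Rolle's theorem a point of `C` lies strictly between any two zeros. Hence zeros outside `C`
are told apart by the set of points of `C` to their left, for which there are finitely many
possibilities. Points where `g` is not differentiable are covered as well, since `deriv` is 0 there
by default. -/
theorem finite_zeros_of_finite_critical {T : ℝ} {g : ℝ → ℝ} (hg : ContinuousOn g (Icc 0 T))
    {C : Set ℝ} (hC : C.Finite) (hgC : ∀ t ∈ Icc 0 T, deriv g t = 0 → t ∈ C) :
    {t ∈ Icc 0 T | g t = 0}.Finite := by
  classical
  refine Set.Finite.subset (s := C ∪ ({t ∈ Icc 0 T | g t = 0} \ C)) (hC.union ?_) (fun t ht => ?_)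
  · refine Set.Finite.of_injOn (f := fun t => C ∩ Iio t) (t := 𝒫 C)
      (fun t _ => inter_subset_left) ?_ hC.powerset
    have key : ∀ s t, s < t → s ∈ {t ∈ Icc 0 T | g t = 0} \ C →
        t ∈ {t ∈ Icc 0 T | g t = 0} \ C → C ∩ Iio s = C ∩ Iio t → False := by
      intro s t hlt hs ht h
      have hsub : Icc s t ⊆ Icc 0 T := Icc_subset_Icc hs.1.1.1 ht.1.1.2
      obtain ⟨z, hz, hz'⟩ := exists_deriv_eq_zero hlt (hg.mono hsub) (hs.1.2.trans ht.1.2.symm)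
      have hzC := hgC z (hsub (Ioo_subset_Icc_self hz)) hz'
      have : z ∈ C ∩ Iio s := by rw [h]; exact ⟨hzC, hz.2⟩
      exact lt_asymm this.2 hz.1
    intro s hs t ht h
    rcases lt_trichotomy s t with hlt | heq | hlt
    · exact (key s t hlt hs ht h).elim
    · exact heq
    · exact (key t s hlt ht hs h.symm).elim
  · by_cases h : t ∈ C
    · exact Or.inl h
    · exact Or.inr ⟨ht, h⟩

end Regularity

/-! ### Which mode is inserted, and where -/

section Insertion

variable {N : ℕ}

theorem maxMap_eq_single {w : Fin N → ℝ} {c : Fin N} (h : ∀ b, b ≠ c → w b < w c) :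
    maxMap w = Pi.single c 1 := by
  funext i
  rw [maxMap]
  by_cases hi : i = c
  · subst hi
    rw [Pi.single_eq_same]
    exact Finset.prod_eq_one fun j hj => if_pos (sub_nonneg.2 (h j (Finset.ne_of_mem_erase hj)).le)
  · rw [Pi.single_eq_of_ne hi]
    exact Finset.prod_eq_zero (Finset.mem_erase.2 ⟨Ne.symm hi, Finset.mem_univ c⟩)
      (if_neg (by have := h i hi; linarith))

theorem le_of_maxMap_eq_single {w : Fin N → ℝ} {c : Fin N} (h : maxMap w = Pi.single c 1)
    (b : Fin N) : w b ≤ w c := by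
  by_contra! hlt
  have h1 := congrFun h c
  rw [Pi.single_eq_same, maxMap, Finset.prod_eq_zero
    (Finset.mem_erase.2 ⟨fun hb : b = c => by rw [hb] at hlt; exact lt_irrefl _ hlt,
      Finset.mem_univ b⟩) (if_neg (by linarith))] at h1
  exact zero_ne_one h1

/-- A switching time that does not depend on `γ`, or moves. -/
def ConstOrMoving (d : ℝ → Fin N → ℝ) (θ γ₀ : ℝ) (α β : Fin N) (r : ℝ → ℝ) (L : ℝ) : Prop :=
  (∀ᶠ γ in 𝓝[>] γ₀, r γ = L) ∨ ∃ a ς D₁ D₂, MovingSwitch d θ γ₀ α β r L a ς D₁ D₂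

theorem tendsto_neg_inv {θ γ₀ : ℝ} (hθ : θ < 0) (hγ₀ : γ₀ = -1 / θ) :
    Tendsto (fun γ : ℝ => -1 / γ) (𝓝[>] γ₀) (𝓝[>] θ) := by
  have hpos : 0 < γ₀ := by rw [hγ₀]; exact div_pos_of_neg_of_neg (by norm_num) hθ
  have hθγ : θ = -1 / γ₀ := by rw [hγ₀]; field_simp
  refine tendsto_nhdsWithin_iff.2 ⟨?_, ?_⟩
  · rw [hθγ]
    exact (ContinuousAt.div continuousAt_const continuousAt_id hpos.ne').tendsto.mono_left
      nhdsWithin_le_nhds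
  · filter_upwards [self_mem_nhdsWithin] with γ hγ
    have hγ : γ₀ < γ := hγ
    rw [mem_Ioi, hθγ, neg_div, neg_div, neg_lt_neg_iff]
    exact one_div_lt_one_div_of_lt hpos hγ

theorem neg_of_ne_zero_Ioo {p q t₀ : ℝ} {F : ℝ → ℝ} (hF : ContinuousOn F (Ioo p q))
    (h0 : ∀ t ∈ Ioo p q, F t ≠ 0) (ht₀ : t₀ ∈ Ioo p q) (hneg : F t₀ ≤ 0) :
    ∀ t ∈ Ioo p q, F t < 0 := by
  intro t ht
  by_contra! hcon
  obtain ⟨z, hz, hz'⟩ := isPreconnected_Ioo.intermediate_value ht₀ ht hF ⟨hneg, hcon⟩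
  exact h0 z hz hz'

/-- On an interval without critical points and ties of the insertion gradients, at most one mode is
inserted, at one of the ends. -/
theorem insertsAtMostOnce_of_regular {d u : ℝ → Fin N → ℝ} {θ γ₀ p q : ℝ} {s : Fin N}
    (hpq : p < q) (hθ : θ < 0) (hγ₀ : γ₀ = -1 / θ) (hu : ∀ t ∈ Ioo p q, u t = Pi.single s 1)
    (hds : ∀ t ∈ Ioo p q, d t s = 0)
    (hreg : ∀ a b, ∃ F₁ F₂, HasTwoDerivs p q (fun t => d t a - d t b) F₁ F₂)
    (hinj : ∀ a b, a ≠ b → InjOn (fun t => d t a - d t b) (Icc p q))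
    (hne : ∀ a b, a ≠ b → ∀ t ∈ Ioo p q, d t a - d t b ≠ 0)
    (hθd : ∀ t ∈ Ioo p q, ∀ a, θ ≤ d t a) :
    InsertsAtMostOnce (ConstOrMoving d θ γ₀) (fun γ t => maxMap (u t - γ • d t)) u γ₀ p q := by
  have hγ₀pos : 0 < γ₀ := by rw [hγ₀]; exact div_pos_of_neg_of_neg (by norm_num) hθ
  have hγpos : ∀ᶠ γ in 𝓝[>] γ₀, 0 < γ := by
    filter_upwards [self_mem_nhdsWithin] with γ hγ using hγ₀pos.trans hγ
  refine ⟨s, hu, ?_⟩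
  have ht₀ : (p + q) / 2 ∈ Ioo p q := ⟨by linarith, by linarith⟩
  have : Nonempty (Fin N) := ⟨s⟩
  -- The differences d_a - d_b have no zeros in (p, q), so a mode with the least insertion gradient
  -- at the midpoint has it on the whole interval.
  obtain ⟨a, ha⟩ := Finite.exists_min (d ((p + q) / 2))
  have hmin : ∀ b, b ≠ a → ∀ t ∈ Ioo p q, d t a < d t b := fun b hb t ht => by
    obtain ⟨F₁, F₂, hF⟩ := hreg a b
    have := neg_of_ne_zero_Ioo (hF.cont.mono Ioo_subset_Icc_self) (hne a b hb.symm) ht₀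
      (sub_nonpos.2 (ha b)) t ht
    linarith
  have hval : ∀ t ∈ Ioo p q, ∀ γ : ℝ, ∀ b, (u t - γ • d t) b = (if b = s then 1 else 0) - γ * d t b :=
    fun t ht γ b => by
      rw [Pi.sub_apply, Pi.smul_apply, smul_eq_mul, hu t ht, Pi.single_apply]
  by_cases has : a = s
  · subst has
    left
    filter_upwards [hγpos] with γ hγ t ht
    refine maxMap_eq_single fun b hb => ?_
    rw [hval t ht, hval t ht, if_neg hb, if_pos rfl]
    have := mul_lt_mul_of_pos_left (hmin b hb t ht) hγ
    linarith
  have hFd : ∀ t ∈ Ioo p q, d t a = d t a - d t s := fun t ht => by rw [hds t ht, sub_zero]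
  -- Only `a` can compete with `s`: the component of u - γd is 1 for `s` and -γ d_b for every other
  -- mode b, and the latter is largest for b = a.
  have hins : ∀ γ : ℝ, 0 < γ → ∀ t ∈ Ioo p q, d t a - d t s < -1 / γ →
      maxMap (u t - γ • d t) = Pi.single a 1 := fun γ hγ t ht hlt => by
    rw [← hFd t ht, lt_div_iff₀ hγ] at hlt
    refine maxMap_eq_single fun b hb => ?_
    rw [hval t ht, hval t ht, if_neg has]
    have := mul_lt_mul_of_pos_left (hmin b hb t ht) hγ
    split_ifs with hbs
    · rw [hbs, hds t ht]; linarith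
    · linarith
  have hnins : ∀ γ : ℝ, 0 < γ → ∀ t ∈ Ioo p q, -1 / γ < d t a - d t s →
      maxMap (u t - γ • d t) = Pi.single s 1 := fun γ hγ t ht hlt => by
    rw [← hFd t ht, div_lt_iff₀ hγ] at hlt
    refine maxMap_eq_single fun b hb => ?_
    rw [hval t ht, hval t ht, if_neg hb, if_pos rfl, hds t ht]
    have : γ * d t a ≤ γ * d t b := by
      by_cases hba : b = a
      · rw [hba]
      · exact mul_le_mul_of_nonneg_left (hmin b hba t ht).le hγ.le
    linarith
  obtain ⟨F₁, F₂, hF⟩ := hreg a s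
  set F : ℝ → ℝ := fun t => d t a - d t s with hFdef
  have hθF : ∀ t ∈ Ioo p q, θ ≤ F t := fun t ht => (hθd t ht a).trans_eq (hFd t ht)
  have hlev := tendsto_neg_inv hθ hγ₀
  have hpI : p ∈ Icc p q := left_mem_Icc.2 hpq.le
  have hqI : q ∈ Icc p q := right_mem_Icc.2 hpq.le
  have hcross : ∀ᶠ γ in 𝓝[>] γ₀, θ < -1 / γ := hlev.eventually self_mem_nhdsWithin
  have hsmall : ∀ z, θ < z → ∀ᶠ γ in 𝓝[>] γ₀, -1 / γ < z := fun z hz =>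
    (hlev.mono_right nhdsWithin_le_nhds).eventually (gt_mem_nhds hz)
  rcases hF.cont.strictMonoOn_of_injOn_Icc' hpq.le (hinj a s has) with hmono | hanti
  -- At an end point the active mode may differ from `s`, so d_s need not vanish there and F p need
  -- not equal d_a(p). The bound is therefore obtained as a limit from inside the interval.
  · have hFp : θ ≤ F p := by
      refine ge_of_tendsto (f := F) (x := 𝓝[>] p) ?_
        (by filter_upwards [Ioo_mem_nhdsGT hpq] with t ht using hθF t ht)
      exact ((continuousWithinAt_Icc_iff_Ici hpq).1 (hF.cont p hpI)).mono Ioi_subset_Ici_self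
    rcases hFp.eq_or_lt with hFp | hFp
    · right
      have hex : ∀ᶠ γ in 𝓝[>] γ₀, ∃ r ∈ Ioo p q, F r = -1 / γ := by
        filter_upwards [hcross, hsmall _ (hFp.trans_lt (hmono hpI hqI hpq))] with γ h1 h2
        exact intermediate_value_Ioo hpq.le hF.cont ⟨hFp ▸ h1, h2⟩
      obtain ⟨r, hr⟩ := hex.choice
      refine ⟨a, r, has, hr.mono fun _ h => h.1, Or.inl ⟨Or.inr ⟨a, 1, F₁ p, F₂ p, ?_⟩, ?_, ?_⟩⟩
      · refine hF.movingSwitch hpq hθ hγ₀ (Or.inl ⟨rfl, rfl, rfl⟩) hFp.symm hFd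
          (fun t _ => (one_mul _).symm) (hr.mono fun _ h => h.1) ?_ (hr.mono fun _ h => h.2)
        -- The level -1/γ eventually drops below the value of `F` at any point to the right of `p`,
        -- and by strict monotonicity `r γ` then lies to the left of that point.
        refine tendsto_order.2 ⟨fun z hz => hr.mono fun γ h => hz.trans h.1.1, fun z hz => ?_⟩
        have hz' : min z q ∈ Icc p q := ⟨le_min hz.le hpq.le, min_le_right _ _⟩
        filter_upwards [hr, hsmall _ (hFp.trans_lt (hmono hpI hz' (lt_min hz hpq)))] with γ h1 h2
        rw [← h1.2] at h2
        exact ((hmono.lt_iff_lt (Ioo_subset_Icc_self h1.1) hz').1 h2).trans_le (min_le_left _ _)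
      · filter_upwards [hr, hγpos] with γ h hγ t ht
        have htI : t ∈ Ioo p q := ⟨ht.1, ht.2.trans h.1.2⟩
        refine hins γ hγ t htI ?_
        rw [← h.2]
        exact hmono (Ioo_subset_Icc_self htI) (Ioo_subset_Icc_self h.1) ht.2
      · filter_upwards [hr, hγpos] with γ h hγ t ht
        have htI : t ∈ Ioo p q := ⟨h.1.1.trans ht.1, ht.2⟩
        refine hnins γ hγ t htI ?_
        rw [← h.2]
        exact hmono (Ioo_subset_Icc_self h.1) (Ioo_subset_Icc_self htI) ht.1
    -- If `F` starts above θ, the level -1/γ eventually lies below all its values and nothing is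
    -- inserted.
    · left
      filter_upwards [hγpos, hsmall _ hFp] with γ hγ h t ht
      exact hnins γ hγ t ht (h.trans (hmono hpI (Ioo_subset_Icc_self ht) ht.1))
  · have hFq : θ ≤ F q := by
      refine ge_of_tendsto (f := F) (x := 𝓝[<] q) ?_
        (by filter_upwards [Ioo_mem_nhdsLT hpq] with t ht using hθF t ht)
      exact ((continuousWithinAt_Icc_iff_Iic hpq).1 (hF.cont q hqI)).mono Iio_subset_Iic_self
    rcases hFq.eq_or_lt with hFq | hFq
    · right
      have hex : ∀ᶠ γ in 𝓝[>] γ₀, ∃ r ∈ Ioo p q, F r = -1 / γ := by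
        filter_upwards [hcross, hsmall _ (hFq.trans_lt (hanti hpI hqI hpq))] with γ h1 h2
        exact intermediate_value_Ioo' hpq.le hF.cont ⟨hFq ▸ h1, h2⟩
      obtain ⟨r, hr⟩ := hex.choice
      refine ⟨a, r, has, hr.mono fun _ h => h.1, Or.inr ⟨Or.inr ⟨a, -1, F₁ q, F₂ q, ?_⟩, ?_, ?_⟩⟩
      · refine hF.movingSwitch hpq hθ hγ₀ (Or.inr ⟨rfl, rfl, rfl⟩) hFq.symm hFd
          (fun t _ => by simp only [hFdef]; ring) (hr.mono fun _ h => h.1) ?_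
          (hr.mono fun _ h => h.2)
        refine tendsto_order.2 ⟨fun z hz => ?_, fun z hz => hr.mono fun γ h => h.1.2.trans hz⟩
        have hz' : max z p ∈ Icc p q := ⟨le_max_right _ _, max_le hz.le hpq.le⟩
        filter_upwards [hr, hsmall _ (hFq.trans_lt (hanti hz' hqI (max_lt hz hpq)))] with γ h1 h2
        rw [← h1.2] at h2
        exact (le_max_left _ _).trans_lt ((hanti.lt_iff_gt (Ioo_subset_Icc_self h1.1) hz').1 h2)
      · filter_upwards [hr, hγpos] with γ h hγ t ht
        have htI : t ∈ Ioo p q := ⟨ht.1, ht.2.trans h.1.2⟩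
        refine hnins γ hγ t htI ?_
        rw [← h.2]
        exact hanti (Ioo_subset_Icc_self htI) (Ioo_subset_Icc_self h.1) ht.2
      · filter_upwards [hr, hγpos] with γ h hγ t ht
        have htI : t ∈ Ioo p q := ⟨h.1.1.trans ht.1, ht.2⟩
        refine hins γ hγ t htI ?_
        rw [← h.2]
        exact hanti (Ioo_subset_Icc_self h.1) (Ioo_subset_Icc_self htI) ht.1
    · left
      filter_upwards [hγpos, hsmall _ hFq] with γ hγ h t ht
      exact hnins γ hγ t ht (h.trans (hanti (Ioo_subset_Icc_self ht) hqI ht.2))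

end Insertion

/-! ### Types of switching times and accuracy of the approximations -/

section Types

variable {N m : ℕ} {d : ℝ → Fin N → ℝ} {θ γ₀ : ℝ}

theorem exists_forall_Ioo_iff_eventually {P : ℝ → Prop} {a : ℝ} :
    (∃ δ > 0, ∀ γ ∈ Ioo a (a + δ), P γ) ↔ ∀ᶠ γ in 𝓝[>] a, P γ := by
  constructor
  · rintro ⟨δ, hδ, h⟩
    filter_upwards [Ioo_mem_nhdsGT (show a < a + δ by linarith)] with γ hγ using h γ hγ
  · intro h
    obtain ⟨b, hb, hsub⟩ := mem_nhdsGT_iff_exists_Ioo_subset.1 h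
    have hb : a < b := hb
    exact ⟨b - a, sub_pos.2 hb, fun γ hγ => hsub (by rwa [add_sub_cancel] at hγ)⟩

theorem MovingSwitch.congr {α β a : Fin N} {r r' : ℝ → ℝ} {L ς D₁ D₂ : ℝ}
    (h : MovingSwitch d θ γ₀ α β r L a ς D₁ D₂) (hr : ∀ᶠ γ in 𝓝[>] γ₀, r γ = r' γ) :
    MovingSwitch d θ γ₀ α β r' L a ς D₁ D₂ where
  mode := h.mode
  tendsto := h.tendsto.congr' hr
  pos := by filter_upwards [h.pos, hr] with γ h1 h2; rwa [← h2]
  deriv_sub := h.deriv_sub.congr' (hr.mono fun γ h => by rw [h])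
  deriv_two_sub := h.deriv_two_sub.congr' (hr.mono fun γ h => by rw [h])
  deriv_mode := h.deriv_mode.congr' (hr.mono fun γ h => by rw [h])
  deriv_two_mode := h.deriv_two_mode.congr' (hr.mono fun γ h => by rw [h])
  asymptotics_one := fun h0 => (h.asymptotics_one h0).congr' (hr.mono fun γ h => by rw [h])
  nonneg := h.nonneg
  asymptotics_two := fun h0 h1 => (h.asymptotics_two h0 h1).imp id
    fun h => h.congr' (hr.mono fun γ h => by rw [h])

theorem ConstOrMoving.congr {α β : Fin N} {r r' : ℝ → ℝ} {L : ℝ}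
    (h : ConstOrMoving d θ γ₀ α β r L) (hr : ∀ᶠ γ in 𝓝[>] γ₀, r γ = r' γ) :
    ConstOrMoving d θ γ₀ α β r' L := by
  rcases h with h | ⟨a, ς, D₁, D₂, h⟩
  · left; filter_upwards [h, hr] with γ h1 h2; rw [← h2, h1]
  · exact Or.inr ⟨a, ς, D₁, D₂, h.congr hr⟩

theorem ConstOrMoving.tendsto {α β : Fin N} {r : ℝ → ℝ} {L : ℝ}
    (h : ConstOrMoving d θ γ₀ α β r L) : Tendsto r (𝓝[>] γ₀) (𝓝 L) := by
  rcases h with h | ⟨a, ς, D₁, D₂, h⟩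
  · exact tendsto_const_nhds.congr' (h.mono fun γ h => h.symm)
  · exact h.tendsto

variable {σ : Fin (m + 1) → Fin N} {τ : ℝ → Fin m → ℝ} {i : Fin m} {L : ℝ}

theorem atSwitch_eq {g : ℝ → ℝ} {z : ℝ} (h : Tendsto (fun γ => g (τ γ i)) (𝓝[>] γ₀) (𝓝 z)) :
    atSwitch γ₀ τ i g = z :=
  rightLim_eq_of_tendsto h

theorem switchType_of_const (h : ∀ᶠ γ in 𝓝[>] γ₀, τ γ i = L) : switchType d γ₀ σ τ i = 0 := by
  rw [switchType, if_pos]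
  obtain ⟨δ, hδ, h⟩ := exists_forall_Ioo_iff_eventually.2 h
  exact ⟨δ, hδ, L, h⟩

variable {a : Fin N} {ς D₁ D₂ : ℝ}

theorem MovingSwitch.sign_sq
    (h : MovingSwitch d θ γ₀ (σ i.castSucc) (σ i.succ) (fun γ => τ γ i) L a ς D₁ D₂) :
    ς * ς = 1 := by
  rcases h.mode with ⟨h, _⟩ | ⟨h, _⟩ <;> rw [h] <;> norm_num

theorem MovingSwitch.abs_sub
    (h : MovingSwitch d θ γ₀ (σ i.castSucc) (σ i.succ) (fun γ => τ γ i) L a ς D₁ D₂) :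
    ∀ᶠ γ in 𝓝[>] γ₀, |τ γ i - L| = ς * (τ γ i - L) := by
  filter_upwards [h.pos] with γ hγ
  rcases h.mode with ⟨hς, _⟩ | ⟨hς, _⟩ <;> rw [hς] at hγ ⊢
  · rw [abs_of_pos (by linarith)]; ring
  · rw [abs_of_neg (by linarith)]; ring

/-- A constant switching time would equal its limit `L`, whereas a moving one is strictly on one
side of `L`; so the type is not 0. -/
theorem MovingSwitch.switchType_eq
    (h : MovingSwitch d θ γ₀ (σ i.castSucc) (σ i.succ) (fun γ => τ γ i) L a ς D₁ D₂) :
    switchType d γ₀ σ τ i = sInf {k : ℕ∞ | ∃ j : ℕ, 1 ≤ j ∧ k = j ∧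
      atSwitch γ₀ τ i (iteratedDeriv j fun s => d s (σ i.castSucc) - d s (σ i.succ)) ≠ 0} := by
  rw [switchType, if_neg]
  rintro ⟨δ, hδ, c, hc⟩
  have hc := exists_forall_Ioo_iff_eventually.1 ⟨δ, hδ, hc⟩
  have hcL : c = L := tendsto_nhds_unique (tendsto_const_nhds.congr' (hc.mono fun γ h => h.symm))
    h.tendsto
  obtain ⟨γ, h1, h2⟩ := (hc.and h.pos).exists
  rw [h1, hcL, sub_self, mul_zero] at h2
  exact lt_irrefl _ h2

theorem MovingSwitch.atSwitch_one
    (h : MovingSwitch d θ γ₀ (σ i.castSucc) (σ i.succ) (fun γ => τ γ i) L a ς D₁ D₂) :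
    atSwitch γ₀ τ i (iteratedDeriv 1 fun s => d s (σ i.castSucc) - d s (σ i.succ)) = ς * D₁ := by
  rw [iteratedDeriv_one]
  exact atSwitch_eq h.deriv_sub

theorem MovingSwitch.switchType_one
    (h : MovingSwitch d θ γ₀ (σ i.castSucc) (σ i.succ) (fun γ => τ γ i) L a ς D₁ D₂)
    (hD₁ : D₁ ≠ 0) : switchType d γ₀ σ τ i = 1 := by
  have hς : ς ≠ 0 := left_ne_zero_of_mul_eq_one h.sign_sq
  rw [h.switchType_eq]
  refine le_antisymm (sInf_le ⟨1, le_rfl, rfl, ?_⟩) (le_sInf ?_)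
  · rw [h.atSwitch_one]; exact mul_ne_zero hς hD₁
  · rintro k ⟨j, hj, rfl, _⟩
    exact_mod_cast hj

theorem MovingSwitch.two_le_switchType
    (h : MovingSwitch d θ γ₀ (σ i.castSucc) (σ i.succ) (fun γ => τ γ i) L a ς D₁ D₂)
    (hD₁ : D₁ = 0) : 2 ≤ switchType d γ₀ σ τ i := by
  rw [h.switchType_eq]
  refine le_sInf ?_
  rintro k ⟨j, hj, rfl, hne⟩
  rcases hj.eq_or_lt with rfl | hj
  · rw [h.atSwitch_one, hD₁, mul_zero] at hne
    exact absurd rfl hne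
  · exact_mod_cast hj

theorem MovingSwitch.switchType_two
    (h : MovingSwitch d θ γ₀ (σ i.castSucc) (σ i.succ) (fun γ => τ γ i) L a ς D₁ D₂)
    (hD₁ : D₁ = 0) (hle : switchType d γ₀ σ τ i ≤ 2) :
    D₂ ≠ 0 ∧ switchType d γ₀ σ τ i = 2 := by
  refine ⟨?_, le_antisymm hle (h.two_le_switchType hD₁)⟩
  rintro rfl
  have : (3 : ℕ∞) ≤ switchType d γ₀ σ τ i := by
    rw [h.switchType_eq]
    refine le_sInf ?_
    rintro k ⟨j, hj, rfl, hne⟩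
    rcases hj.eq_or_lt with rfl | hj
    · rw [h.atSwitch_one, hD₁, mul_zero] at hne
      exact absurd rfl hne
    · rcases (Nat.succ_le_of_lt hj).eq_or_lt with rfl | hj
      · rw [atSwitch_eq h.deriv_two_sub, mul_zero] at hne
        exact absurd rfl hne
      · exact_mod_cast hj
  exact absurd (this.trans hle) (by decide)

theorem MovingSwitch.isIncreasingSwitch_iff
    (h : MovingSwitch d θ γ₀ (σ i.castSucc) (σ i.succ) (fun γ => τ γ i) L a ς D₁ D₂) :
    IsIncreasingSwitch γ₀ τ i ↔ ς = 1 := by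
  have hL : atSwitch γ₀ τ i id = L := atSwitch_eq h.tendsto
  rw [IsIncreasingSwitch, exists_forall_Ioo_iff_eventually, hL]
  constructor
  · intro hinc
    rcases h.mode with ⟨hς, _⟩ | ⟨hς, _⟩
    · exact hς
    · obtain ⟨γ, h1, h2⟩ := (hinc.and h.pos).exists
      rw [hς] at h2
      linarith
  · rintro rfl
    filter_upwards [h.pos] with γ hγ
    linarith

theorem MovingSwitch.movingMode_eq
    (h : MovingSwitch d θ γ₀ (σ i.castSucc) (σ i.succ) (fun γ => τ γ i) L a ς D₁ D₂) :
    movingMode γ₀ σ τ i = a := by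
  rw [movingMode, h.isIncreasingSwitch_iff]
  rcases h.mode with ⟨hς, ha⟩ | ⟨hς, ha⟩
  · rw [if_pos hς, ha]
  · rw [if_neg (by rw [hς]; norm_num), ha]

theorem MovingSwitch.neg_one_pow_omega
    (h : MovingSwitch d θ γ₀ (σ i.castSucc) (σ i.succ) (fun γ => τ γ i) L a ς D₁ D₂) :
    (-1 : ℝ) ^ omega γ₀ τ i = ς := by
  rw [omega, h.isIncreasingSwitch_iff]
  rcases h.mode with ⟨hς, _⟩ | ⟨hς, _⟩
  · rw [if_pos hς, hς, pow_zero]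
  · rw [if_neg (by rw [hς]; norm_num), hς, pow_one]

/-- The displacement of a switching time of type at most one. -/
theorem ConstOrMoving.displacement_one (hθ : θ < 0)
    (h : ConstOrMoving d θ γ₀ (σ i.castSucc) (σ i.succ) (fun γ => τ γ i) L)
    (hle : switchType d γ₀ σ τ i ≤ 1) :
    ∃ S ≥ 0, Tendsto (fun γ => |τ γ i - L| / (γ - γ₀)) (𝓝[>] γ₀) (𝓝 S) ∧
      (switchType d γ₀ σ τ i = 1 → 0 < S) ∧
      (if switchType d γ₀ σ τ i = 1 then (-1) ^ omega γ₀ τ i * θ ^ 3 /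
        atSwitch γ₀ τ i (deriv fun s => d s (movingMode γ₀ σ τ i)) else 0) = θ * S := by
  rcases h with h | ⟨a, ς, D₁, D₂, h⟩
  · have h0 : switchType d γ₀ σ τ i = 0 := switchType_of_const h
    refine ⟨0, le_rfl, tendsto_const_nhds.congr' ?_, fun h1 => ?_, ?_⟩
    · filter_upwards [h] with γ hγ; simp [hγ]
    · rw [h0] at h1; exact absurd h1 zero_ne_one
    · rw [h0, if_neg zero_ne_one, mul_zero]
  · have hD₁ : D₁ ≠ 0 := fun h0 =>
      absurd ((h.two_le_switchType h0).trans hle) (by decide)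
    have hς := h.sign_sq
    have hς0 : ς ≠ 0 := left_ne_zero_of_mul_eq_one hς
    have hpos : 0 < ς * D₁ := lt_of_le_of_ne h.nonneg (mul_ne_zero hς0 hD₁).symm
    have hS : 0 < θ ^ 2 / (ς * D₁) := div_pos (sq_pos_of_neg hθ) hpos
    refine ⟨θ ^ 2 / (ς * D₁), hS.le, (h.asymptotics_one hD₁).congr' ?_, fun _ => hS, ?_⟩
    · filter_upwards [h.abs_sub] with γ hγ; rw [hγ]
    · rw [if_pos (h.switchType_one hD₁), h.neg_one_pow_omega, h.movingMode_eq,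
        atSwitch_eq h.deriv_mode]
      field_simp
      rw [sq, hς, one_mul]

/-- The displacement of a switching time of type at most two. -/
theorem ConstOrMoving.displacement_two (hθ : θ < 0)
    (h : ConstOrMoving d θ γ₀ (σ i.castSucc) (σ i.succ) (fun γ => τ γ i) L)
    (hle : switchType d γ₀ σ τ i ≤ 2) :
    ∃ S ≥ 0, Tendsto (fun γ => |τ γ i - L| / √(γ - γ₀)) (𝓝[>] γ₀) (𝓝 S) ∧
      (switchType d γ₀ σ τ i = 2 → 0 < S) ∧
      (if switchType d γ₀ σ τ i = 2 then √2 * θ ^ 2 /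
        √(atSwitch γ₀ τ i (iteratedDeriv 2 fun s => d s (movingMode γ₀ σ τ i))) else 0) =
          -(θ * S) := by
  rcases h with h | ⟨a, ς, D₁, D₂, h⟩
  · have h0 : switchType d γ₀ σ τ i = 0 := switchType_of_const h
    have h02 : (0 : ℕ∞) ≠ 2 := by decide
    refine ⟨0, le_rfl, tendsto_const_nhds.congr' ?_, fun h1 => ?_, ?_⟩
    · filter_upwards [h] with γ hγ; simp [hγ]
    · rw [h0] at h1; exact absurd h1 h02
    · rw [h0, if_neg h02, mul_zero, neg_zero]
  · by_cases hD₁ : D₁ = 0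
    · obtain ⟨hD₂, h2⟩ := h.switchType_two hD₁ hle
      obtain ⟨hpos, hlim⟩ := h.asymptotics_two hD₁ hD₂
      have hS : 0 < √2 * |θ| / √D₂ := by
        have := abs_pos.2 hθ.ne
        positivity
      refine ⟨√2 * |θ| / √D₂, hS.le, hlim.congr' ?_, fun _ => hS, ?_⟩
      · filter_upwards [h.abs_sub] with γ hγ; rw [hγ]
      · rw [if_pos h2, h.movingMode_eq, atSwitch_eq h.deriv_two_mode, abs_of_neg hθ]
        ring
    -- A switching time of type one moves at the rate γ - γ₀, which is negligible against √(γ - γ₀).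
    -- This is why such times do not enter Ĵ(2; γ).
    · have h12 : switchType d γ₀ σ τ i ≠ 2 := by rw [h.switchType_one hD₁]; decide
      refine ⟨0, le_rfl, ?_, fun h1 => absurd h1 h12, by rw [if_neg h12, mul_zero, neg_zero]⟩
      have hsq : Tendsto (fun γ => √(γ - γ₀)) (𝓝[>] γ₀) (𝓝 0) := by
        have : Continuous fun γ => √(γ - γ₀) := by fun_prop
        simpa using (this.tendsto γ₀).mono_left nhdsWithin_le_nhds
      have := (h.asymptotics_one hD₁).mul hsq
      rw [mul_zero] at this
      refine this.congr' ?_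
      filter_upwards [h.abs_sub, self_mem_nhdsWithin] with γ hγ hγ'
      have hpos : 0 < γ - γ₀ := sub_pos.2 hγ'
      rw [hγ, div_mul_eq_mul_div, div_eq_div_iff hpos.ne' (Real.sqrt_pos.2 hpos).ne', mul_assoc,
        Real.mul_self_sqrt hpos.le]

/-- An approximation that captures the leading term of the cost has the asserted accuracy. -/
theorem eventually_abs_sub_le {J A E φ : ℝ → ℝ} {J₀ S C : ℝ} (hθ : θ < 0) (hγ₀ : γ₀ = -1 / θ)
    (hφ : ∀ᶠ γ in 𝓝[>] γ₀, 0 < φ γ) (hφ0 : Tendsto φ (𝓝[>] γ₀) (𝓝 0))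
    (hE : Tendsto (fun γ => E γ / φ γ) (𝓝[>] γ₀) (𝓝 S)) (hS : 0 < S)
    (hJ : ∀ᶠ γ in 𝓝[>] γ₀, θ * E γ - C * E γ ^ 2 ≤ J γ - J₀ ∧
      J γ - J₀ ≤ -1 / γ * E γ + C * E γ ^ 2)
    (hA : ∀ γ, A γ = J₀ + θ * S * φ γ) :
    ∀ᶠ γ in 𝓝[>] γ₀, |A γ - J₀| ≥ |J γ - A γ| := by
  have hlev := (tendsto_neg_inv hθ hγ₀).mono_right nhdsWithin_le_nhds
  have hE0 : Tendsto E (𝓝[>] γ₀) (𝓝 0) := by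
    have := hE.mul hφ0
    rw [mul_zero] at this
    refine this.congr' ?_
    filter_upwards [hφ] with γ hγ
    field_simp
  have hq : Tendsto (fun γ => C * (E γ / φ γ * E γ)) (𝓝[>] γ₀) (𝓝 0) := by
    simpa using (hE.mul hE0).const_mul C
  have hlow := (hE.const_mul θ).sub hq
  have hup := (hlev.mul hE).add hq
  rw [sub_zero] at hlow
  rw [add_zero] at hup
  -- The lower and upper bounds for J - J₀ have the same limit after division by φ, because -1/γ → θ
  -- and E² = o(φ).
  have hlim : Tendsto (fun γ => (J γ - J₀) / φ γ) (𝓝[>] γ₀) (𝓝 (θ * S)) := by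
    refine tendsto_of_tendsto_of_tendsto_of_le_of_le' hlow hup ?_ ?_
    · filter_upwards [hφ, hJ] with γ h1 h2
      rw [le_div_iff₀ h1]
      refine le_trans (le_of_eq ?_) h2.1
      field_simp
    · filter_upwards [hφ, hJ] with γ h1 h2
      rw [div_le_iff₀ h1]
      refine h2.2.trans (le_of_eq ?_)
      generalize -1 / γ = z
      field_simp
  have hrem : Tendsto (fun γ => |(J γ - J₀) / φ γ - θ * S|) (𝓝[>] γ₀) (𝓝 0) := by
    simpa using (hlim.sub_const (θ * S)).abs
  have hpos : 0 < |θ * S| := abs_pos.2 (mul_ne_zero hθ.ne hS.ne')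
  filter_upwards [hφ, hrem.eventually (gt_mem_nhds hpos)] with γ h1 h2
  have e1 : J γ - A γ = ((J γ - J₀) / φ γ - θ * S) * φ γ := by
    rw [hA, sub_mul, div_mul_cancel₀ _ h1.ne']; ring
  have e2 : A γ - J₀ = θ * S * φ γ := by rw [hA]; ring
  rw [e1, e2, abs_mul, abs_mul _ (φ γ)]
  exact mul_le_mul_of_nonneg_right h2.le (abs_nonneg _)

/-- The supremum over an empty set of switching times is 0; in all other cases it is a maximum.
Attainment makes the leading coefficient strictly positive. -/
theorem exists_switchType_eq_maxType (hk : maxType d γ₀ σ τ ≠ 0) :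
    ∃ i, switchType d γ₀ σ τ i = maxType d γ₀ σ τ := by
  rcases (Finset.univ : Finset (Fin m)).eq_empty_or_nonempty with h | h
  · rw [maxType, h, Finset.sup_empty] at hk
    exact absurd rfl hk
  · obtain ⟨i, _, hi⟩ := Finset.exists_mem_eq_sup _ h (switchType d γ₀ σ τ)
    exact ⟨i, hi.symm⟩

theorem switchType_le_maxType (i : Fin m) : switchType d γ₀ σ τ i ≤ maxType d γ₀ σ τ :=
  Finset.le_sup (f := switchType d γ₀ σ τ) (Finset.mem_univ i)

/-- The approximation of first order is accurate. -/
theorem eventually_approxCostOne {J : ℝ → ℝ} {J₀ C : ℝ} {Λ : Fin m → ℝ} (hθ : θ < 0)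
    (hγ₀ : γ₀ = -1 / θ) (hmax : maxType d γ₀ σ τ = 1)
    (hsw : ∀ i, ConstOrMoving d θ γ₀ (σ i.castSucc) (σ i.succ) (fun γ => τ γ i) (Λ i))
    (hJ : ∀ᶠ γ in 𝓝[>] γ₀, θ * (∑ i, |τ γ i - Λ i|) - C * (∑ i, |τ γ i - Λ i|) ^ 2 ≤ J γ - J₀ ∧
      J γ - J₀ ≤ -1 / γ * (∑ i, |τ γ i - Λ i|) + C * (∑ i, |τ γ i - Λ i|) ^ 2) :
    ∀ᶠ γ in 𝓝[>] γ₀, |approxCostOne J₀ θ d γ₀ σ τ γ - J₀| ≥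
      |J γ - approxCostOne J₀ θ d γ₀ σ τ γ| := by
  choose S hS0 hS hSpos hterm using fun i => (hsw i).displacement_one hθ
    ((switchType_le_maxType i).trans_eq hmax)
  obtain ⟨i, hi⟩ := exists_switchType_eq_maxType (by rw [hmax]; exact one_ne_zero)
  refine eventually_abs_sub_le (φ := fun γ => γ - γ₀) (S := ∑ i, S i) hθ hγ₀ ?_ ?_ ?_
    (Finset.sum_pos' (fun i _ => hS0 i) ⟨i, Finset.mem_univ i, hSpos i (hi.trans hmax)⟩) hJ
    fun γ => ?_
  · filter_upwards [self_mem_nhdsWithin] with γ hγ using sub_pos.2 hγ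
  · have : Continuous fun γ => γ - γ₀ := by fun_prop
    simpa using (this.tendsto γ₀).mono_left nhdsWithin_le_nhds
  · simp only [Finset.sum_div]
    exact tendsto_finsetSum _ fun i _ => hS i
  · rw [approxCostOne, typeSet, Finset.sum_filter, Finset.mul_sum]
    congr 2
    exact Finset.sum_congr rfl fun i _ => by
      rw [← hterm i]

/-- The approximation of order one half is accurate. -/
theorem eventually_approxCostTwo {J : ℝ → ℝ} {J₀ C : ℝ} {Λ : Fin m → ℝ} (hθ : θ < 0)
    (hγ₀ : γ₀ = -1 / θ) (hmax : maxType d γ₀ σ τ = 2)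
    (hsw : ∀ i, ConstOrMoving d θ γ₀ (σ i.castSucc) (σ i.succ) (fun γ => τ γ i) (Λ i))
    (hJ : ∀ᶠ γ in 𝓝[>] γ₀, θ * (∑ i, |τ γ i - Λ i|) - C * (∑ i, |τ γ i - Λ i|) ^ 2 ≤ J γ - J₀ ∧
      J γ - J₀ ≤ -1 / γ * (∑ i, |τ γ i - Λ i|) + C * (∑ i, |τ γ i - Λ i|) ^ 2) :
    ∀ᶠ γ in 𝓝[>] γ₀, |approxCostTwo J₀ θ d γ₀ σ τ γ - J₀| ≥
      |J γ - approxCostTwo J₀ θ d γ₀ σ τ γ| := by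
  choose S hS0 hS hSpos hterm using fun i => (hsw i).displacement_two hθ
    ((switchType_le_maxType i).trans_eq hmax)
  obtain ⟨i, hi⟩ := exists_switchType_eq_maxType (by rw [hmax]; exact two_ne_zero)
  refine eventually_abs_sub_le (φ := fun γ => √(γ - γ₀)) (S := ∑ i, S i) hθ hγ₀ ?_ ?_ ?_
    (Finset.sum_pos' (fun i _ => hS0 i) ⟨i, Finset.mem_univ i, hSpos i (hi.trans hmax)⟩) hJ
    fun γ => ?_
  · filter_upwards [self_mem_nhdsWithin] with γ hγ using Real.sqrt_pos.2 (sub_pos.2 hγ)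
  · have : Continuous fun γ => √(γ - γ₀) := by fun_prop
    simpa using (this.tendsto γ₀).mono_left nhdsWithin_le_nhds
  · simp only [Finset.sum_div]
    exact tendsto_finsetSum _ fun i _ => hS i
  · rw [approxCostTwo, typeSet, Finset.sum_filter, Finset.mul_sum, sub_eq_add_neg, ← neg_mul,
      ← Finset.sum_neg_distrib]
    congr 2
    exact Finset.sum_congr rfl fun i _ => by
      rw [hterm i, neg_neg]

end Types

/-! ### Schedules of the projected controls and bounds for their cost -/

section Main

variable {n N m₀ : ℕ} {T : ℝ} {f : Fin N → State n → State n} {ℓ : State n → ℝ} {x₀ : State n}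
  {σ₀ : Fin (m₀ + 1) → Fin N} {τ₀ : Fin m₀ → ℝ} {x ρ : ℝ → State n}

theorem insertionGradient_scheduleControl (t : ℝ) (a : Fin N) :
    insertionGradient f x (scheduleControl σ₀ τ₀) ρ t a =
      inner ℝ (ρ t) (f a (x t) - f (activeMode σ₀ τ₀ t) (x t)) := by
  rw [insertionGradient, scheduleControl, field_single]

/-- The term with `u` cancels, so differences of insertion gradients are continuous on [0, T],
although each d_a may jump at the switching times of `u`. -/
theorem insertionGradient_sub (u : ℝ → Fin N → ℝ) (t : ℝ) (a b : Fin N) :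
    insertionGradient f x u ρ t a - insertionGradient f x u ρ t b =
      inner ℝ (ρ t) (f a (x t) - f b (x t)) := by
  rw [insertionGradient, insertionGradient, ← inner_sub_right]
  congr 1
  abel

/-- Between switching times (x, ρ) solves an autonomous equation with a C¹ right-hand side, and the
difference is a C² function of (x, ρ). -/
theorem hasTwoDerivs_insertionGradient_sub (hf : ∀ a, ContDiff ℝ 2 (f a)) (hℓ : ContDiff ℝ 2 ℓ)
    (hT : 0 ≤ T) (hx : IsTrajectory f x₀ T (scheduleControl σ₀ τ₀) x)
    (hρ : IsAdjoint f ℓ T σ₀ τ₀ x ρ) {p q : ℝ} (hp : 0 ≤ p) (hq : q ≤ T) {s : Fin N}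
    (hτ : ∀ t ∈ Ioo p q, t ∉ range τ₀) (hs : ∀ t ∈ Ioo p q, activeMode σ₀ τ₀ t = s)
    (u : ℝ → Fin N → ℝ) (a b : Fin N) :
    ∃ F₁ F₂, HasTwoDerivs p q
      (fun t => insertionGradient f x u ρ t a - insertionGradient f x u ρ t b) F₁ F₂ := by
  simp only [insertionGradient_sub]
  refine exists_hasTwoDerivs_comp (ξ := fun t => (x t, ρ t))
    (Φ := fun e : State n × State n => inner ℝ e.2 (f a e.1 - f b e.1))
    (contDiff_snd.inner ℝ (((hf a).comp contDiff_fst).sub ((hf b).comp contDiff_fst)))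
    (contDiff_adjoint_system (hf s) hℓ)
    (((hx.continuousOn hT).prodMk hρ.continuousOn).mono (Icc_subset_Icc hp hq)) fun t ht => ?_
  have htT : t ∈ Ioo 0 T := ⟨hp.trans_lt ht.1, ht.2.trans_le hq⟩
  have dx := hx.hasDerivAt (fun a => (hf a).continuous) htT (eventually_activeMode_eq (hτ t ht))
  have dρ := hρ.hasDerivAt t htT (hτ t ht)
  rw [hs t ht] at dx dρ
  exact dx.prodMk dρ

theorem activeMode_eq_of_Ioo {p q : ℝ} (hτ : ∀ t ∈ Ioo p q, t ∉ range τ₀) {s t : ℝ}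
    (hs : s ∈ Ioo p q) (ht : t ∈ Ioo p q) : activeMode σ₀ τ₀ s = activeMode σ₀ τ₀ t := by
  refine activeMode_congr fun i => ?_
  have hi : τ₀ i ≤ p ∨ q ≤ τ₀ i := by
    by_contra! h
    exact hτ _ h ⟨i, rfl⟩
  rcases hi with hi | hi
  · exact ⟨fun _ => hi.trans ht.1.le, fun _ => hi.trans hs.1.le⟩
  · exact ⟨fun h => absurd (hi.trans h) hs.2.not_ge, fun h => absurd (hi.trans h) ht.2.not_ge⟩

/-- The infimum is meaningful only for a set that is bounded below. The bound comes from the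
finitely many continuous functions ⟨ρ, f_a(x)⟩, two of which make up each value. -/
theorem theta_le (hf : ∀ a, Continuous (f a)) (hxc : ContinuousOn x (Icc 0 T))
    (hρc : ContinuousOn ρ (Icc 0 T)) {t : ℝ} (ht : t ∈ Icc 0 T) (a : Fin N) :
    theta T (insertionGradient f x (scheduleControl σ₀ τ₀) ρ) ≤
      insertionGradient f x (scheduleControl σ₀ τ₀) ρ t a := by
  obtain ⟨B, _, hB⟩ := exists_bound_finite isCompact_Icc
    (fun (a : Fin N) t => (inner ℝ (ρ t) (f a (x t)) : ℝ))
    fun a => hρc.inner ((hf a).comp_continuousOn hxc)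
  refine csInf_le ⟨-(B + B), ?_⟩ ⟨a, t, ht, rfl⟩
  rintro _ ⟨b, s, hs, rfl⟩
  rw [insertionGradient_scheduleControl, inner_sub_right]
  have h1 := neg_le_of_abs_le (hB b s hs)
  have h2 := le_of_abs_le (hB (activeMode σ₀ τ₀ s) s hs)
  linarith

/-- The controls `𝒬(u - γ d)` have mode schedules with a common mode sequence, whose switching times
are constant or move away from fixed times. -/
theorem exists_schedule (hf : ∀ a, ContDiff ℝ 2 (f a)) (hℓ : ContDiff ℝ 2 ℓ) (hT : 0 < T)
    (hsched : IsModeSchedule T σ₀ τ₀) (hx : IsTrajectory f x₀ T (scheduleControl σ₀ τ₀) x)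
    (hρ : IsAdjoint f ℓ T σ₀ τ₀ x ρ) {d : ℝ → Fin N → ℝ}
    (hd : d = insertionGradient f x (scheduleControl σ₀ τ₀) ρ)
    (hcrit : ∀ a b : Fin N, a ≠ b → (criticalPoints T d a b).Finite) {θ γ₀ : ℝ}
    (hθ : θ = theta T d) (hθneg : θ < 0) (hγ₀ : γ₀ = -1 / θ) :
    ∃ (m : ℕ) (σ : Fin (m + 1) → Fin N) (τ : ℝ → Fin m → ℝ) (Λ : Fin m → ℝ),
      (∀ i, ConstOrMoving d θ γ₀ (σ i.castSucc) (σ i.succ) (fun γ => τ γ i) (Λ i)) ∧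
      ∀ᶠ γ in 𝓝[>] γ₀,
        HasSchedule T σ (τ γ) (fun t => maxMap (scheduleControl σ₀ τ₀ t - γ • d t)) ∧
        ∫ t in (0 : ℝ)..T, disagreement (fun t => maxMap (scheduleControl σ₀ τ₀ t - γ • d t))
          (scheduleControl σ₀ τ₀) t = ∑ i, |τ γ i - Λ i| := by
  have hxc := hx.continuousOn hT.le
  have hcont : ∀ a b, ContinuousOn (fun t => d t a - d t b) (Icc 0 T) := fun a b => by
    simp only [hd, insertionGradient_sub]
    exact hρ.continuousOn.inner (((hf a).continuous.comp_continuousOn hxc).sub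
      ((hf b).continuous.comp_continuousOn hxc))
  have hzeros : ∀ a b, a ≠ b → {t ∈ Icc 0 T | d t a - d t b = 0}.Finite := fun a b hab =>
    finite_zeros_of_finite_critical (hcont a b) (hcrit a b hab) fun t ht h => ⟨ht, Or.inr h⟩
  -- Between neighbouring points of `B` the control `u` has one mode, the differences d_a - d_b have
  -- no zeros, and by Rolle they are injective.
  let B : Set ℝ := {0, T} ∪ range τ₀ ∪ ⋃ a : Fin N, ⋃ b : Fin N, ⋃ _ : a ≠ b,
    (criticalPoints T d a b ∪ {t ∈ Icc 0 T | d t a - d t b = 0})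
  have hBfin : B.Finite := by
    refine ((toFinite _).union (finite_range τ₀)).union ?_
    exact finite_iUnion fun a => finite_iUnion fun b => finite_iUnion fun hab =>
      (hcrit a b hab).union (hzeros a b hab)
  have hBsub : ∀ z ∈ B, z ∈ Icc 0 T := by
    rintro z ((hz | ⟨i, rfl⟩) | hz)
    · rcases hz with rfl | rfl
      exacts [left_mem_Icc.2 hT.le, right_mem_Icc.2 hT.le]
    · exact Ioo_subset_Icc_self (hsched.mem_Ioo i)
    · simp only [mem_iUnion] at hz
      obtain ⟨a, b, _, hz | hz⟩ := hz <;> exact hz.1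
  have h0B : (0 : ℝ) ∈ B := Or.inl (Or.inl (Or.inl rfl))
  have hTB : T ∈ B := Or.inl (Or.inl (Or.inr rfl))
  have : Nonempty (Fin N) := ⟨σ₀ 0⟩
  obtain ⟨c, m, σ, τ, Λ, -, hG, hev⟩ := exists_hasSchedulePrefix (G := ConstOrMoving d θ γ₀)
    (v := fun γ t => maxMap (scheduleControl σ₀ τ₀ t - γ • d t)) (u := scheduleControl σ₀ τ₀)
    (γ₀ := γ₀) (fun α β L => Or.inl (Eventually.of_forall fun _ => rfl)) hBfin h0B
    (fun z hz => (hBsub z hz).1) (fun p hp q hq hpq hgap => by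
      have hnot : ∀ t ∈ Ioo p q, t ∉ B := fun t ht htB =>
        (hgap t htB).elim (fun h => absurd ht.1 h.not_gt) fun h => absurd ht.2 h.not_gt
      have hp0 := (hBsub p hp).1
      have hqT := (hBsub q hq).2
      have hsub : ∀ t ∈ Ioo p q, t ∈ Icc 0 T := fun t ht =>
        ⟨hp0.trans ht.1.le, ht.2.le.trans hqT⟩
      have hτ : ∀ t ∈ Ioo p q, t ∉ range τ₀ := fun t ht h => hnot t ht (Or.inl (Or.inr h))
      have hmem : ∀ a b, a ≠ b → ∀ t ∈ Ioo p q,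
          t ∉ criticalPoints T d a b ∪ {t ∈ Icc 0 T | d t a - d t b = 0} := fun a b hab t ht h =>
        hnot t ht (Or.inr (by simp only [mem_iUnion]; exact ⟨a, b, hab, h⟩))
      have ht₀ : (p + q) / 2 ∈ Ioo p q := ⟨by linarith, by linarith⟩
      have hs : ∀ t ∈ Ioo p q, activeMode σ₀ τ₀ t = activeMode σ₀ τ₀ ((p + q) / 2) :=
        fun t ht => activeMode_eq_of_Ioo hτ ht ht₀
      refine insertsAtMostOnce_of_regular (s := activeMode σ₀ τ₀ ((p + q) / 2)) hpq hθneg hγ₀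
        (fun t ht => by rw [scheduleControl, hs t ht])
        (fun t ht => by rw [hd, insertionGradient_scheduleControl, hs t ht, sub_self,
          inner_zero_right])
        (fun a b => ?_) (fun a b hab s hsI t htI h => ?_)
        (fun a b hab t ht h => hmem a b hab t ht (Or.inr ⟨hsub t ht, h⟩)) (fun t ht a => ?_)
      · rw [hd]
        exact hasTwoDerivs_insertionGradient_sub hf hℓ hT.le hx hρ hp0 hqT hτ hs _ a b
      · have key : ∀ s ∈ Icc p q, ∀ t ∈ Icc p q, s < t → d s a - d s b = d t a - d t b → False := by
          intro s hs t ht hlt h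
          obtain ⟨z, hz, hz'⟩ := exists_deriv_eq_zero hlt
            ((hcont a b).mono (Icc_subset_Icc (hp0.trans hs.1) (ht.2.trans hqT))) h
          have hzI : z ∈ Ioo p q := ⟨hs.1.trans_lt hz.1, hz.2.trans_le ht.2⟩
          exact hmem a b hab z hzI (Or.inl ⟨hsub z hzI, Or.inr hz'⟩)
        rcases lt_trichotomy s t with hlt | heq | hlt
        · exact (key s hsI t htI hlt h).elim
        · exact heq
        · exact (key t htI s hsI hlt h.symm).elim
      · rw [hθ, hd]
        exact theta_le (fun a => (hf a).continuous) hxc hρ.continuousOn (hsub t ht) a) T hTB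
  refine ⟨m, σ, τ, Λ, hG, ?_⟩
  filter_upwards [hev] with γ ⟨_, h1, h2, _, h3⟩
  refine ⟨⟨h1, ?_⟩, by rw [h3, add_zero]⟩
  rw [← restrict_Ioc_eq_restrict_Icc]
  exact (ae_restrict_iff' measurableSet_Ioc).2 h2

/-- Needed at γ = 0, where it identifies J(0) with the cost of the given pair (x, u). -/
theorem maxMap_scheduleControl (t : ℝ) :
    maxMap (scheduleControl σ₀ τ₀ t) = scheduleControl σ₀ τ₀ t := by
  rw [scheduleControl]
  refine maxMap_eq_single fun b hb => ?_
  rw [Pi.single_eq_same, Pi.single_eq_of_ne hb]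
  exact zero_lt_one

/-- Feasibility of `𝒫(u - γ d)`, and bounds of its cost by the duration of the disagreement with
`u`. -/
theorem eventually_feasible_and_cost_bounds (hf : ∀ a, ContDiff ℝ 2 (f a)) (hℓ : ContDiff ℝ 2 ℓ)
    (hfb : ∃ K : ℝ, ∀ a y, ‖iteratedFDeriv ℝ 2 (f a) y‖ ≤ K)
    (hℓb : ∃ K : ℝ, ∀ y, ‖iteratedFDeriv ℝ 2 ℓ y‖ ≤ K) (hT : 0 < T)
    (hx : IsTrajectory f x₀ T (scheduleControl σ₀ τ₀) x)
    (hρ : IsAdjoint f ℓ T σ₀ τ₀ x ρ) {d : ℝ → Fin N → ℝ}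
    (hd : d = insertionGradient f x (scheduleControl σ₀ τ₀) ρ) {θ γ₀ : ℝ}
    (hθ : θ = theta T d) (hγ₀ : 0 < γ₀) {m : ℕ} {σ : Fin (m + 1) → Fin N} {τ : ℝ → Fin m → ℝ}
    {E : ℝ → ℝ} (hE : Tendsto E (𝓝[>] γ₀) (𝓝 0))
    (hev : ∀ᶠ γ in 𝓝[>] γ₀,
        HasSchedule T σ (τ γ) (fun t => maxMap (scheduleControl σ₀ τ₀ t - γ • d t)) ∧
        ∫ t in (0 : ℝ)..T, disagreement (fun t => maxMap (scheduleControl σ₀ τ₀ t - γ • d t))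
          (scheduleControl σ₀ τ₀) t = E γ)
    {J : ℝ → ℝ}
    (hJ : ∀ γ, J γ = cost ℓ T (maxProj f x₀ T fun t => scheduleControl σ₀ τ₀ t - γ • d t)) :
    ∃ C, ∀ᶠ γ in 𝓝[>] γ₀,
      IsFeasible f x₀ T (maxProj f x₀ T fun t => scheduleControl σ₀ τ₀ t - γ • d t) ∧
      θ * E γ - C * E γ ^ 2 ≤ J γ - J 0 ∧ J γ - J 0 ≤ -1 / γ * E γ + C * E γ ^ 2 := by
  obtain ⟨ε, hε, C, hC, H⟩ := exists_cost_expansion hT.le hf hℓ hfb hℓb hx hρ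
  have hxc := hx.continuousOn hT.le
  have hJ0 : J 0 = ∫ s in (0 : ℝ)..T, ℓ (x s) := by
    have htraj : IsTrajectory f x₀ T (scheduleControl σ₀ τ₀)
        (maxProj f x₀ T fun t => scheduleControl σ₀ τ₀ t - (0 : ℝ) • d t).1 := by
      have hex : ∃ y, IsTrajectory f x₀ T
          (fun t => maxMap (scheduleControl σ₀ τ₀ t - (0 : ℝ) • d t)) y :=
        ⟨x, by simpa only [zero_smul, sub_zero, maxMap_scheduleControl] using hx⟩
      have := Classical.epsilon_spec hex
      simpa only [maxProj, zero_smul, sub_zero, maxMap_scheduleControl] using this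
    -- The trajectory picked by `Classical.epsilon` is not literally `x`. The cost expansion with
    -- zero mismatch shows that it has the same cost.
    have := (H m₀ σ₀ τ₀ (by rw [mismatch_self]; exact hε.le)).2 _ htraj
    simp only [mismatch_self, sub_self, inner_zero_right, intervalIntegral.integral_zero,
      sub_zero, ne_eq, OfNat.ofNat_ne_zero, not_false_eq_true, zero_pow, mul_zero] at this
    rw [hJ, cost]
    exact sub_eq_zero.1 (abs_nonpos_iff.1 this)
  have hγpos : ∀ᶠ γ in 𝓝[>] γ₀, 0 < γ := by
    filter_upwards [self_mem_nhdsWithin] with γ hγ using hγ₀.trans hγ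
  refine ⟨C, ?_⟩
  filter_upwards [hev, hE.eventually (gt_mem_nhds hε), hγpos] with γ ⟨hS, hdis⟩ hEε hγ
  set v : ℝ → Fin N → ℝ := fun t => maxMap (scheduleControl σ₀ τ₀ t - γ • d t) with hv
  set c := activeMode σ (τ γ)
  set c₀ := activeMode σ₀ τ₀
  have hae : ∀ᵐ t, t ∈ Icc 0 T → v t = scheduleControl σ (τ γ) t :=
    (ae_restrict_iff' measurableSet_Icc).1 hS.2
  have hmis : mismatch T c c₀ = E γ := by
    rw [← hdis, mismatch]
    refine intervalIntegral.integral_congr_ae ?_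
    filter_upwards [hae] with t ht htI
    rw [uIoc_of_le hT.le] at htI
    rw [disagreement, ht ⟨htI.1.le, htI.2⟩]
    exact if_congr single_one_inj.symm rfl rfl
  obtain ⟨⟨y, hy⟩, hcost⟩ := H m σ (τ γ) (hmis.trans_le hEε.le)
  have hytraj : IsTrajectory f x₀ T v (maxProj f x₀ T fun t => scheduleControl σ₀ τ₀ t - γ • d t).1 :=
    Classical.epsilon_spec (p := IsTrajectory f x₀ T v)
      ⟨y, hy.congr_ae hT.le (hS.2.mono fun t ht => ht.symm)⟩
  refine ⟨⟨⟨m, σ, τ γ, hS⟩, hytraj⟩, ?_⟩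
  have hexp := hcost _ (hytraj.congr_ae hT.le hS.2)
  rw [← hJ0, hmis] at hexp
  change |cost ℓ T (maxProj f x₀ T fun t => scheduleControl σ₀ τ₀ t - γ • d t) - J 0 - _| ≤ _ at hexp
  rw [← hJ] at hexp
  have hcm : Measurable c := measurable_activeMode
  have hcm₀ : Measurable c₀ := measurable_activeMode
  have imis := intervalIntegrable_ite_mode hcm hcm₀ 0 T
  have hd' : ∀ t a, d t a = inner ℝ (ρ t) (f a (x t) - f (c₀ t) (x t)) := fun t a => by
    rw [hd, insertionGradient_scheduleControl]
  have iI : IntervalIntegrable (fun s => (inner ℝ (ρ s) (f (c s) (x s) - f (c₀ s) (x s)) : ℝ))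
      volume 0 T := by
    have i : ∀ {k : ℝ → Fin N}, Measurable k →
        IntervalIntegrable (fun t => (inner ℝ (ρ t) (f (k t) (x t)) : ℝ)) volume 0 T := fun hk =>
      intervalIntegrable_mode hT.le hk (φ := fun a t => (inner ℝ (ρ t) (f a (x t)) : ℝ))
        fun a => hρ.continuousOn.inner ((hf a).continuous.comp_continuousOn hxc)
    simpa only [inner_sub_right] using (i hcm).sub (i hcm₀)
  have hlow : θ * E γ ≤ ∫ s in (0 : ℝ)..T, (inner ℝ (ρ s) (f (c s) (x s) - f (c₀ s) (x s)) : ℝ) := by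
    rw [← hmis, mismatch, ← intervalIntegral.integral_const_mul]
    refine intervalIntegral.integral_mono_on hT.le (imis.const_mul θ) iI fun t ht => ?_
    split_ifs with h
    · rw [h, sub_self, inner_zero_right, mul_zero]
    · rw [mul_one, ← hd', hθ, hd]
      exact theta_le (fun a => (hf a).continuous) hxc hρ.continuousOn ht _
  have hup : ∫ s in (0 : ℝ)..T, (inner ℝ (ρ s) (f (c s) (x s) - f (c₀ s) (x s)) : ℝ) ≤
      -1 / γ * E γ := by
    rw [← hmis, mismatch, ← intervalIntegral.integral_const_mul]
    refine intervalIntegral.integral_mono_ae_restrict hT.le iI (imis.const_mul _) ?_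
    refine (ae_restrict_iff' measurableSet_Icc).2 ?_
    filter_upwards [hae] with t ht htI
    split_ifs with h
    · rw [h, sub_self, inner_zero_right, mul_zero]
    · rw [mul_one, ← hd', le_div_iff₀ hγ]
      -- The selected mode maximizes u - γd. Comparison with the mode of `u`, whose component is 1,
      -- gives 1 ≤ -γ d_c.
      have h1 := le_of_maxMap_eq_single (c := c t) (ht htI) (c₀ t)
      rw [Pi.sub_apply, Pi.sub_apply, Pi.smul_apply, Pi.smul_apply, scheduleControl,
        Pi.single_eq_same, Pi.single_eq_of_ne h, hd' t (activeMode σ₀ τ₀ t), sub_self,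
        inner_zero_right, smul_zero, smul_eq_mul] at h1
      linarith
  have h1 := abs_le.1 hexp
  constructor <;> linarith [h1.1, h1.2]

end Main

end SwitchedSystem

open SwitchedSystem
theorem mainTheorem1 {n N m₀ : ℕ} (T : ℝ) (hT : 0 < T)
    (f : Fin N → State n → State n) (ℓ : State n → ℝ) (x₀ : State n)
    (hf : ∀ a, ContDiff ℝ 2 (f a)) (hℓ : ContDiff ℝ 2 ℓ)
    (hfb : ∃ K : ℝ, ∀ a y, ‖iteratedFDeriv ℝ 2 (f a) y‖ ≤ K)
    (hℓb : ∃ K : ℝ, ∀ y, ‖iteratedFDeriv ℝ 2 ℓ y‖ ≤ K)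
    (σ₀ : Fin (m₀ + 1) → Fin N) (τ₀ : Fin m₀ → ℝ) (hsched : IsModeSchedule T σ₀ τ₀)
    (u : ℝ → Fin N → ℝ) (hu : u = scheduleControl σ₀ τ₀)
    (x : ℝ → State n) (hx : IsTrajectory f x₀ T u x)
    (ρ : ℝ → State n) (hρ : IsAdjoint f ℓ T σ₀ τ₀ x ρ)
    (d : ℝ → Fin N → ℝ) (hd : d = insertionGradient f x u ρ)
    (hcrit : ∀ a b : Fin N, a ≠ b → (criticalPoints T d a b).Finite)
    (θ : ℝ) (hθ : θ = theta T d) (hθneg : θ < 0)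
    (γ₀ : ℝ) (hγ₀ : γ₀ = -1 / θ)
    (J : ℝ → ℝ) (hJ : ∀ γ, J γ = cost ℓ T (maxProj f x₀ T fun t => u t - γ • d t)) :
    (∃ (m : ℕ) (σ : Fin (m + 1) → Fin N) (τ : ℝ → Fin m → ℝ), IsScheduleAfter T u d γ₀ σ τ) ∧
    ∀ (m : ℕ) (σ : Fin (m + 1) → Fin N) (τ : ℝ → Fin m → ℝ), IsScheduleAfter T u d γ₀ σ τ →
      (maxType d γ₀ σ τ = 1 →
        ∃ δ > 0, ∀ γ ∈ Set.Ioo γ₀ (γ₀ + δ),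
          IsFeasible f x₀ T (maxProj f x₀ T fun t => u t - γ • d t) ∧
          |approxCostOne (J 0) θ d γ₀ σ τ γ - J 0| ≥
            |J γ - approxCostOne (J 0) θ d γ₀ σ τ γ|) ∧
      (maxType d γ₀ σ τ = 2 →
        ∃ δ > 0, ∀ γ ∈ Set.Ioo γ₀ (γ₀ + δ),
          IsFeasible f x₀ T (maxProj f x₀ T fun t => u t - γ • d t) ∧
          |approxCostTwo (J 0) θ d γ₀ σ τ γ - J 0| ≥
            |J γ - approxCostTwo (J 0) θ d γ₀ σ τ γ|) := by
  subst hu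
  have hγ₀pos : 0 < γ₀ := by rw [hγ₀]; exact div_pos_of_neg_of_neg (by norm_num) hθneg
  obtain ⟨m', σ', τ', Λ, hG, hev⟩ :=
    exists_schedule hf hℓ hT hsched hx hρ hd hcrit hθ hθneg hγ₀
  refine ⟨⟨m', σ', τ', exists_forall_Ioo_iff_eventually.2 (hev.mono fun γ h => h.1)⟩, ?_⟩
  intro m σ τ hafter
  have hafter := exists_forall_Ioo_iff_eventually.1 hafter
  -- The mode sequences do not depend on γ, so a single value of γ at which both schedules are valid
  -- identifies their lengths and modes. The switching times are then identified for each γ near γ₀.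
  obtain ⟨γ₁, h1, h2⟩ := (hafter.and hev).exists
  obtain rfl := h1.length_eq h2.1
  obtain ⟨rfl, -⟩ := h1.unique hT h2.1
  have hτ : ∀ᶠ γ in 𝓝[>] γ₀, τ' γ = τ γ := by
    filter_upwards [hafter, hev] with γ h1 h2 using (h1.unique hT h2.1).2.symm
  have hsw : ∀ i, ConstOrMoving d θ γ₀ (σ i.castSucc) (σ i.succ) (fun γ => τ γ i) (Λ i) := fun i =>
    (hG i).congr (hτ.mono fun γ h => by rw [h])
  have hev' : ∀ᶠ γ in 𝓝[>] γ₀,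
      HasSchedule T σ (τ γ) (fun t => maxMap (scheduleControl σ₀ τ₀ t - γ • d t)) ∧
      ∫ t in (0 : ℝ)..T, disagreement (fun t => maxMap (scheduleControl σ₀ τ₀ t - γ • d t))
        (scheduleControl σ₀ τ₀) t = ∑ i, |τ γ i - Λ i| := by
    filter_upwards [hev, hτ] with γ h1 h2
    rwa [h2] at h1
  have hE : Tendsto (fun γ => ∑ i, |τ γ i - Λ i|) (𝓝[>] γ₀) (𝓝 0) := by
    have := tendsto_finsetSum Finset.univ fun i _ => ((hsw i).tendsto.sub_const (Λ i)).abs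
    simpa using this
  obtain ⟨C, hC⟩ :=
    eventually_feasible_and_cost_bounds hf hℓ hfb hℓb hT hx hρ hd hθ hγ₀pos hE hev' hJ
  have hfeas := hC.mono fun γ h => h.1
  have hbounds := hC.mono fun γ h => h.2
  exact ⟨fun hmax => exists_forall_Ioo_iff_eventually.2
      (hfeas.and (eventually_approxCostOne hθneg hγ₀ hmax hsw hbounds)),
    fun hmax => exists_forall_Ioo_iff_eventually.2
      (hfeas.and (eventually_approxCostTwo hθneg hγ₀ hmax hsw hbounds))⟩
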